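/- Let $n\ge 2$, let $M$ be an $n$-dimensional smooth manifold, $h$ a smooth Riemannian metric on $M$, and $W$ a smooth vector field on all of $M$ with $h(W,W)=1$ that is a Killing field, i.e. $W_{i||j}+W_{j||i}=0$ in every coordinate system, where $||$ is the Levi-Civita covariant derivative of $h$. Let $k$ be any smooth function on $M$ and put $a_{ij}=e^{-k}h_{ij}$, $b_i=2e^{-k}W_i$ (with $W_i=h_{ij}W^j$), $\alpha^2(x,y)=a_{ij}(x)y^iy^j$, $\beta(x,y)=b_i(x)y^i$. Let $$F(x,y)=\frac{\alpha^2(x,y)}{\beta(x,y)}=\frac{h(y,y)}{2h(W,y)},\qquad (x,y)\in A:=\{(x,y)\in TM:\ \beta(x,y)>0\},$$ be the UK-Kropina metric induced by the navigation data $(h,W)$. Call a (conic) Finsler metric $F:A\to(0,\infty)$, $A\subseteq TM$, projectively flat if $M$ is covered by coordinate neighbourhoods in which it has rectilinear extremals: a smooth curve $c:[a,b]\to U$ ($a<b$) in such a neighbourhood $U$ with $\dot c(t)\in A$ for all $t\in[a,b]$ is a critical curve, for variations with fixed end points, of the length functional $c\mapsto\int_a^bF(c,\dot c)\,dt$ if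 and only if, in these coordinates, its image lies on a straight line. Call the Riemannian space $(M,h)$ projectively flat if the metric $\sqrt{h(y,y)}$ on the nonzero tangent vectors is projectively flat in this sense. Then $(M,F)$ is projectively flat if and only if $W$ is parallel on $(M,h)$ (that is, $W_{i||j}=0$ in every coordinate system) and $(M,h)$ is projectively flat. -/

import Mathlib

open scoped Manifold ContDiff

noncomputable section

namespace KropinaGeometry

/-- The coordinate space `ℝⁿ`. -/
abbrev Coord (n : ℕ) : Type := EuclideanSpace ℝ (Fin n)

variable {n : ℕ} {M : Type*} [TopologicalSpace M] [ChartedSpace (Coord n) M]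

/-! ### Reading tangent vectors in a coordinate system -/

/-- For a coordinate system `φ` on `M`, the tangent vector `yⁱ ∂/∂xⁱ` of `M` at the point with
coordinates `x`. -/
def coordVec (φ : OpenPartialHomeomorph M (Coord n)) (x y : Coord n) :
    TangentSpace (𝓡 n) (φ.symm x) :=
  mfderiv 𝓘(ℝ, Coord n) (𝓡 n) φ.symm x y

/-- The components `Wⁱ` in the coordinate system `φ` of a vector field `W`, at the point with
coordinates `x`. -/
def coordField (φ : OpenPartialHomeomorph M (Coord n))
    (W : (p : M) → TangentSpace (𝓡 n) p) (x : Coord n) : Coord n :=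
  mfderiv (𝓡 n) 𝓘(ℝ, Coord n) φ (φ.symm x) (W (φ.symm x))

/-! ### Extremals of the length functional and projective flatness

A conic Finsler metric is given by its conic domain `A ⊆ TM` and by the function `F`, whose values
outside `A` play no role. -/

/-- `c : [a, b] → ℝⁿ` is (the coordinate expression of) a smooth `F`-admissible curve in the
coordinate neighbourhood of `φ`: its velocity lies in the conic domain `A` at all times. Smoothness
on `[a, b]` is expressed through a smooth extension to the line. -/
def IsAdmissible (A : Set (TangentBundle (𝓡 n) M)) (φ : OpenPartialHomeomorph M (Coord n))
    (a b : ℝ) (c : ℝ → Coord n) : Prop :=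
  ContDiff ℝ ∞ c ∧ ∀ t ∈ Set.Icc a b, c t ∈ φ.target ∧
    (⟨φ.symm (c t), coordVec φ (c t) (deriv c t)⟩ : TangentBundle (𝓡 n) M) ∈ A

/-- The `F`-length `∫ F(c, ċ) dt` over `[a, b]` of the curve with coordinate expression `c`. -/
def length (F : TangentBundle (𝓡 n) M → ℝ) (φ : OpenPartialHomeomorph M (Coord n))
    (a b : ℝ) (c : ℝ → Coord n) : ℝ :=
  ∫ t in a..b, F ⟨φ.symm (c t), coordVec φ (c t) (deriv c t)⟩

/-- `c` is an extremal: it is a critical curve of the length functional among the curves with the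
same end points, i.e. the first variation of the length vanishes for every smooth variation field
`η` with `η a = η b = 0`. -/
def IsExtremal (F : TangentBundle (𝓡 n) M → ℝ) (φ : OpenPartialHomeomorph M (Coord n))
    (a b : ℝ) (c : ℝ → Coord n) : Prop :=
  ∀ η : ℝ → Coord n, ContDiff ℝ ∞ η → η a = 0 → η b = 0 →
    HasDerivAt (fun s : ℝ => length F φ a b (fun t => c t + s • η t)) 0 0

/-- In the coordinate system `φ` the extremals of `(A, F)` are exactly the admissible curves that
run along straight lines. -/
def HasRectilinearExtremals (A : Set (TangentBundle (𝓡 n) M)) (F : TangentBundle (𝓡 n) M → ℝ)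
    (φ : OpenPartialHomeomorph M (Coord n)) : Prop :=
  ∀ (a b : ℝ) (c : ℝ → Coord n), a < b → IsAdmissible A φ a b c →
    (IsExtremal F φ a b c ↔ Collinear ℝ (c '' Set.Icc a b))

/-- `(M, F)`, with conic domain `A`, is projectively flat: `M` is covered by coordinate
neighbourhoods in which the extremals are rectilinear. -/
def IsProjectivelyFlat (A : Set (TangentBundle (𝓡 n) M)) (F : TangentBundle (𝓡 n) M → ℝ) : Prop :=
  ∀ p : M, ∃ φ ∈ IsManifold.maximalAtlas (𝓡 n) ∞ M,
    p ∈ φ.source ∧ HasRectilinearExtremals A F φ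

variable [IsManifold (𝓡 n) ∞ M]

/-! ### Riemannian metrics -/

variable (n M) in
/-- Smooth Riemannian metrics on `M`. -/
abbrev RiemMetric : Type _ :=
  Bundle.ContMDiffRiemannianMetric (𝓡 n) ∞ (Coord n) (fun p : M => TangentSpace (𝓡 n) p)

/-- The components of the metric: `h_ij(x) uⁱ vʲ`. -/
def metricCoord (h : RiemMetric n M) (φ : OpenPartialHomeomorph M (Coord n))
    (x u v : Coord n) : ℝ :=
  h.inner (φ.symm x) (coordVec φ x u) (coordVec φ x v)

/-- The covariant components of a vector field: `W_i(x) vⁱ`, where `W_i = h_ij Wʲ`. -/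
def coField (h : RiemMetric n M) (W : (p : M) → TangentSpace (𝓡 n) p)
    (φ : OpenPartialHomeomorph M (Coord n)) (x v : Coord n) : ℝ :=
  h.inner (φ.symm x) (W (φ.symm x)) (coordVec φ x v)

/-- The Christoffel symbols of the first kind, `h_sr γʳ_ij uⁱ vʲ wˢ`, that is
`½ (∂_i h_js + ∂_j h_is - ∂_s h_ij) uⁱ vʲ wˢ` at `x`. -/
def christoffel (h : RiemMetric n M) (φ : OpenPartialHomeomorph M (Coord n))
    (x u v w : Coord n) : ℝ :=
  (fderiv ℝ (fun z => metricCoord h φ z v w) x u + fderiv ℝ (fun z => metricCoord h φ z u w) x v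
    - fderiv ℝ (fun z => metricCoord h φ z u v) x w) / 2

/-- The Levi-Civita covariant derivative `W_{i||j} vⁱ uʲ` at `x`, where
`W_{i||j} = ∂_j W_i - γʳ_ij W_r`; here `γʳ_ij W_r` is written as `(h_sr γʳ_ij) Wˢ`. -/
def covDeriv (h : RiemMetric n M) (W : (p : M) → TangentSpace (𝓡 n) p)
    (φ : OpenPartialHomeomorph M (Coord n)) (x v u : Coord n) : ℝ :=
  fderiv ℝ (fun z => coField h W φ z v) x u - christoffel h φ x v u (coordField φ W x)

/-- `W` is a Killing vector field: `W_{i||j} + W_{j||i} = 0` in all coordinate systems. -/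
def IsKilling (h : RiemMetric n M) (W : (p : M) → TangentSpace (𝓡 n) p) : Prop :=
  ∀ φ ∈ IsManifold.maximalAtlas (𝓡 n) ∞ M, ∀ x ∈ φ.target, ∀ v u : Coord n,
    covDeriv h W φ x v u + covDeriv h W φ x u v = 0

/-- `W` is parallel: `W_{i||j} = 0` in all coordinate systems. -/
def IsParallel (h : RiemMetric n M) (W : (p : M) → TangentSpace (𝓡 n) p) : Prop :=
  ∀ φ ∈ IsManifold.maximalAtlas (𝓡 n) ∞ M, ∀ x ∈ φ.target, ∀ v u : Coord n,
    covDeriv h W φ x v u = 0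

/-- The Riemannian space `(M, h)` is projectively flat, as the Finsler space with metric
`√(h(y, y))` on the nonzero tangent vectors. -/
def IsRiemProjectivelyFlat (h : RiemMetric n M) : Prop :=
  IsProjectivelyFlat {y : TangentBundle (𝓡 n) M | y.2 ≠ 0}
    (fun y => Real.sqrt (h.inner y.1 y.2 y.2))

/-! ### The Kropina metric of the navigation data -/

/-- `α² = a_ij yⁱ yʲ` with `a_ij = e^{-k} h_ij`. -/
def alphaSq (h : RiemMetric n M) (k : M → ℝ) (y : TangentBundle (𝓡 n) M) : ℝ :=
  Real.exp (-k y.1) * h.inner y.1 y.2 y.2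

/-- `β = b_i yⁱ` with `b_i = 2 e^{-k} W_i`. -/
def beta (h : RiemMetric n M) (W : (p : M) → TangentSpace (𝓡 n) p) (k : M → ℝ)
    (y : TangentBundle (𝓡 n) M) : ℝ :=
  2 * Real.exp (-k y.1) * h.inner y.1 (W y.1) y.2

/-- The conic domain `β > 0` of the Kropina metric. -/
def kropinaDomain (h : RiemMetric n M) (W : (p : M) → TangentSpace (𝓡 n) p) (k : M → ℝ) :
    Set (TangentBundle (𝓡 n) M) :=
  {y | 0 < beta h W k y}

/-- The Kropina metric `F = α² / β`, to be used on the domain `β > 0`. -/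
def kropinaMetric (h : RiemMetric n M) (W : (p : M) → TangentSpace (𝓡 n) p) (k : M → ℝ)
    (y : TangentBundle (𝓡 n) M) : ℝ :=
  alphaSq h k y / beta h W k y

end KropinaGeometry

end

/-!
Everything happens in one coordinate domain `U`, and in fact in the *same* coordinates for `F` and
for `h`. Write `N = h(y, y)`, `ω = W_i yⁱ`, and let `Γ` be the 1-form dual to the covariant
acceleration `c̈ + γ(ċ, ċ)` of a curve with velocity `y` (`accelForm`).

A curve is critical for the length if and only if it solves the Euler–Lagrange equation
(`isCritical_iff_eulerLagrange`). For `√h(y, y)` this equation says that `Γ` is proportional to the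
dual of `y` (`eulerLagrange_riem_iff`). For the Kropina metric `N / (2ω)` of a unit Killing field
it reads, for all `v`,
`ω² Γ(v) - ω h(y, v) Γ(W) - ω W_i vⁱ Γ(y) + N W_i vⁱ Γ(W) = N ω W_{i||j} vⁱ yʲ`
(`eulerLagrange_kropina_iff`).

If `W` is parallel, the right-hand side vanishes and the equation again says that `Γ` is
proportional to the dual of `y` (`kropina_equation_iff_of_parallel`), so both metrics have the same
extremals among the curves admissible for `F`. Conversely, let all straight lines be extremals of
`F`. Then `Γ = γ(y, y)`, and the equation is polynomial in `y` on the half-space `ω > 0`. Inserting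
`v = W`, where `W_{i||j} Wⁱ = 0` because `W` has constant length, gives `N Γ(W) = ω Γ(y)`. After
division by `ω`, the equation becomes `ω Γ(v) - h(y, v) Γ(W) = N W_{i||j} vⁱ yʲ`. On the boundary
`ω = 0` the first relation forces `Γ(W) = 0`, and the second one forces `W_{i||j} vⁱ yʲ = 0`. Since
also `W_{i||j} Wʲ = 0`, the field is parallel
(`parallel_and_geodesic_of_kropina_equation`). With `W` parallel, straight lines are geodesics up to
parametrization in all directions with `ω > 0`, hence, by symmetry and continuity, in all
directions. This makes the extremals of `h` rectilinear, because a curve is straight exactly when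
its acceleration is proportional to its velocity (`collinear_image_iff`).

The vanishing of `W_{i||j}` is obtained in one chart around each point. It passes to all other
charts because for a Killing field `W_{i||j}` is, up to sign, half the exterior derivative of
`W_i`, and closedness is invariant under pull-back (`covDeriv_eq_zero_of_chart`).
-/

noncomputable section

namespace KropinaGeometry

open Set MeasureTheory Filter Topology

/-! ### The Euler–Lagrange equation -/

section EulerLagrange

variable {E : Type*} [NormedAddCommGroup E] [NormedSpace ℝ E]

/-- The first variation of a Lagrangian along a variation field `η`. -/
theorem hasDerivAt_action {L : E × E → ℝ} {Ω : Set (E × E)} (hΩ : IsOpen Ω)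
    (hL : ContDiffOn ℝ 2 L Ω) {a b : ℝ} (hab : a ≤ b) {c η : ℝ → E}
    (hc : ContDiff ℝ ∞ c) (hη : ContDiff ℝ ∞ η) (hcΩ : ∀ t ∈ Icc a b, (c t, deriv c t) ∈ Ω) :
    HasDerivAt (fun s : ℝ => ∫ t in a..b, L (c t + s • η t, deriv (fun t => c t + s • η t) t))
      (∫ t in a..b, fderiv ℝ L (c t, deriv c t) (η t, deriv η t)) 0 := by
  have hc1 : Continuous (deriv c) := hc.continuous_deriv (by simp)
  have hη1 : Continuous (deriv η) := hη.continuous_deriv (by simp)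
  have hcd : Differentiable ℝ c := hc.differentiable (by simp)
  have hηd : Differentiable ℝ η := hη.differentiable (by simp)
  let Φ : ℝ × ℝ → E × E := fun p => (c p.2 + p.1 • η p.2, deriv c p.2 + p.1 • deriv η p.2)
  have hΦ : Continuous Φ := by
    have := hc.continuous
    have := hη.continuous
    fun_prop
  have hderiv : ∀ s t : ℝ, deriv (fun t => c t + s • η t) t = deriv c t + s • deriv η t :=
    fun s t => ((hcd t).hasDerivAt.add ((hηd t).hasDerivAt.const_smul s)).deriv
  -- By compactness of `[a, b]` the varied curves stay in `Ω` for all small parameters.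
  obtain ⟨U, V, hU, -, hU0, hV, hUV⟩ := generalized_tube_lemma (s := {(0 : ℝ)})
    isCompact_singleton (isCompact_Icc (a := a) (b := b)) (hΩ.preimage hΦ) (by
      rintro ⟨s, t⟩ ⟨hs, ht⟩
      obtain rfl : s = 0 := hs
      simpa [Φ] using hcΩ t ht)
  obtain ⟨δ, hδ, hδU⟩ := Metric.isOpen_iff.1 hU 0 (hU0 rfl)
  have hmem : ∀ s ∈ Icc (-(δ / 2)) (δ / 2), ∀ t ∈ Icc a b, Φ (s, t) ∈ Ω := fun s hs t ht =>
    hUV ⟨hδU (by rw [Metric.mem_ball, dist_zero_right, Real.norm_eq_abs, abs_lt]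
                 constructor <;> linarith [hs.1, hs.2]), hV ht⟩
  have hK : IsCompact (Icc (-(δ / 2)) (δ / 2) ×ˢ Icc a b) := isCompact_Icc.prod isCompact_Icc
  have hLcont : ContinuousOn (fun p => L (Φ p)) (Icc (-(δ / 2)) (δ / 2) ×ˢ Icc a b) :=
    hL.continuousOn.comp hΦ.continuousOn fun p hp => hmem _ hp.1 _ hp.2
  have hDcont : ContinuousOn (fun p : ℝ × ℝ => fderiv ℝ L (Φ p) (η p.2, deriv η p.2))
      (Icc (-(δ / 2)) (δ / 2) ×ˢ Icc a b) := by
    refine ContinuousOn.clm_apply (((hL.continuousOn_fderiv_of_isOpen hΩ (by simp)).comp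
      hΦ.continuousOn fun p hp => hmem _ hp.1 _ hp.2)) ?_
    have := hη.continuous
    fun_prop
  obtain ⟨B, hB⟩ := hK.exists_bound_of_continuousOn hDcont
  have hIoc : uIoc a b ⊆ Icc a b := by rw [uIoc_of_le hab]; exact Ioc_subset_Icc_self
  have hslice : ∀ s : ℝ, s ∈ Icc (-(δ / 2)) (δ / 2) → ∀ f : ℝ × ℝ → ℝ,
      ContinuousOn f (Icc (-(δ / 2)) (δ / 2) ×ˢ Icc a b) →
      ContinuousOn (fun t => f (s, t)) (Icc a b) := fun s hs f hf =>
    hf.comp (by fun_prop) fun t ht => ⟨hs, ht⟩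
  have h0 : (0 : ℝ) ∈ Icc (-(δ / 2)) (δ / 2) := ⟨by linarith, by linarith⟩
  have hnhds : Icc (-(δ / 2)) (δ / 2) ∈ 𝓝 (0 : ℝ) := Icc_mem_nhds (by linarith) (by linarith)
  have key := (intervalIntegral.hasDerivAt_integral_of_dominated_loc_of_deriv_le
    (μ := volume) (a := a) (b := b) (F := fun s t => L (Φ (s, t)))
    (F' := fun s t => fderiv ℝ L (Φ (s, t)) (η t, deriv η t)) (bound := fun _ => B)
    hnhds ?_ ?_ ?_ ?_ ?_ ?_).2
  · simpa only [Φ, zero_smul, add_zero, hderiv] using key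
  · filter_upwards [hnhds] with s hs
    exact ((hslice s hs _ hLcont).mono hIoc).aestronglyMeasurable measurableSet_uIoc
  · refine ContinuousOn.intervalIntegrable ?_
    rw [uIcc_of_le hab]
    exact hslice 0 h0 _ hLcont
  · exact ((hslice 0 h0 _ hDcont).mono hIoc).aestronglyMeasurable measurableSet_uIoc
  · exact Eventually.of_forall fun t ht s hs => hB (s, t) ⟨hs, hIoc ht⟩
  · exact intervalIntegrable_const
  · refine Eventually.of_forall fun t ht s hs => ?_
    have h1 : HasFDerivAt L (fderiv ℝ L (Φ (s, t))) (Φ (s, t)) :=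
      (((hL.contDiffAt (hΩ.mem_nhds (hmem s hs t (hIoc ht)))).differentiableAt
        (by simp))).hasFDerivAt
    have h2 : HasDerivAt (fun s => Φ (s, t)) (η t, deriv η t) s := by
      have h := (((hasDerivAt_id s).smul_const (η t)).const_add (c t)).prodMk
        (((hasDerivAt_id s).smul_const (deriv η t)).const_add (deriv c t))
      simpa [Φ] using h
    exact h1.comp_hasDerivAt s h2

/-- The fundamental lemma of the calculus of variations, for covector-valued functions. -/
theorem eq_zero_of_forall_integral_eq_zero {f : ℝ → E →L[ℝ] ℝ} {a b : ℝ} (hab : a ≤ b)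
    (hf : ContinuousOn f (Icc a b))
    (H : ∀ η : ℝ → E, ContDiff ℝ ∞ η → η a = 0 → η b = 0 → ∫ t in a..b, f t (η t) = 0) :
    ∀ t ∈ Ioo a b, f t = 0 := by
  intro t ht
  ext v
  have hfv : ContinuousOn (fun t => f t v) (Ioo a b) :=
    (hf.clm_apply continuousOn_const).mono Ioo_subset_Icc_self
  have hae : ∀ᵐ x ∂(volume : Measure ℝ), x ∈ Ioo a b → f x v = 0 := by
    refine isOpen_Ioo.ae_eq_zero_of_integral_contDiff_smul_eq_zero
      (hfv.locallyIntegrableOn measurableSet_Ioo) fun ψ hψ _ hsupp => ?_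
    have hz : ∀ x, x ∉ Ioo a b → ψ x = 0 := fun x hx =>
      image_eq_zero_of_notMem_tsupport fun h => hx (hsupp h)
    have h1 := H (fun t => ψ t • v) (hψ.smul contDiff_const)
      (by simp [hz a (by simp)]) (by simp [hz b (by simp)])
    rw [intervalIntegral.integral_of_le hab] at h1
    rw [← h1, ← setIntegral_eq_integral_of_forall_compl_eq_zero (s := Ioc a b)]
    · simp
    · intro x hx
      rw [hz x fun h => hx (Ioo_subset_Ioc_self h), zero_smul]
  rw [← ae_restrict_iff' measurableSet_Ioo] at hae
  exact Measure.eqOn_open_of_ae_eq hae isOpen_Ioo hfv continuousOn_const ht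

/-- The curve `c` is critical for the action `∫ L(c, ċ) dt` over `[a, b]` under variations that fix
the end points. -/
def IsCritical (L : E × E → ℝ) (a b : ℝ) (c : ℝ → E) : Prop :=
  ∀ η : ℝ → E, ContDiff ℝ ∞ η → η a = 0 → η b = 0 →
    HasDerivAt (fun s : ℝ => ∫ t in a..b,
      L (c t + s • η t, deriv (fun t => c t + s • η t) t)) 0 0

/-- A curve is critical for the action of `L` if and only if it solves the Euler–Lagrange
equation. -/
theorem isCritical_iff_eulerLagrange {L : E × E → ℝ} {Ω : Set (E × E)} (hΩ : IsOpen Ω)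
    (hL : ContDiffOn ℝ 2 L Ω) {a b : ℝ} (hab : a ≤ b) {c : ℝ → E}
    (hc : ContDiff ℝ ∞ c) (hcΩ : ∀ t ∈ Icc a b, (c t, deriv c t) ∈ Ω) :
    IsCritical L a b c ↔ ∀ t ∈ Ioo a b, ∀ v : E,
      HasDerivAt (fun τ => fderiv ℝ L (c τ, deriv c τ) (0, v))
        (fderiv ℝ L (c t, deriv c t) (v, 0)) t := by
  have hc1 : ContDiff ℝ ∞ (deriv c) := (contDiff_infty_iff_deriv.1 hc).2
  set k : ℝ → E × E →L[ℝ] ℝ := fun t => fderiv ℝ L (c t, deriv c t) with hk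
  have hk1 : ∀ t ∈ Icc a b, ContDiffAt ℝ 1 k t := fun t ht =>
    ((hL.contDiffAt (hΩ.mem_nhds (hcΩ t ht))).fderiv_right (m := 1) (by norm_num)).comp t
      ((hc.prodMk hc1).contDiffAt.of_le (by simp))
  have hkd : ∀ t ∈ Icc a b, HasDerivAt k (deriv k t) t := fun t ht =>
    ((hk1 t ht).differentiableAt (by simp)).hasDerivAt
  have hkc : ContinuousOn k (Icc a b) := fun t ht => (hk1 t ht).continuousAt.continuousWithinAt
  have hk'c : ContinuousOn (deriv k) (Icc a b) := fun t ht => by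
    have h : ContDiffAt ℝ 0 (fderiv ℝ k) t := (hk1 t ht).fderiv_right (by norm_num)
    have h2 : deriv k = fun t => fderiv ℝ k t 1 := by ext1 t; rw [fderiv_apply_one_eq_deriv]
    rw [h2]
    exact (h.continuousAt.clm_apply continuousAt_const).continuousWithinAt
  -- The Euler–Lagrange expression, as a covector along the curve.
  set e : ℝ → E →L[ℝ] ℝ := fun t => (k t).comp (ContinuousLinearMap.inl ℝ E E) -
    (deriv k t).comp (ContinuousLinearMap.inr ℝ E E) with he
  have hec : ContinuousOn e (Icc a b) :=
    (hkc.clm_comp continuousOn_const).sub (hk'c.clm_comp continuousOn_const)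
  have hparts : ∀ η : ℝ → E, ContDiff ℝ ∞ η → η a = 0 → η b = 0 →
      ∫ t in a..b, k t (η t, deriv η t) = ∫ t in a..b, e t (η t) := by
    intro η hη ha hb
    have hηd : Differentiable ℝ η := hη.differentiable (by simp)
    have hη1 : Continuous (deriv η) := hη.continuous_deriv (by simp)
    have hη0 := hη.continuous
    have hB : ∀ t ∈ uIcc a b, HasDerivAt (fun t => k t (0, η t))
        (k t (0, deriv η t) + deriv k t (0, η t)) t := by
      intro t ht
      rw [uIcc_of_le hab] at ht
      have := (hkd t ht).clm_apply (((hasDerivAt_const t (0 : E))).prodMk (hηd t).hasDerivAt)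
      rwa [add_comm] at this
    have hi1 : ContinuousOn (fun t => k t (η t, deriv η t)) (Icc a b) :=
      hkc.clm_apply (by fun_prop)
    have hi2 : ContinuousOn (fun t => k t (0, deriv η t) + deriv k t (0, η t)) (Icc a b) :=
      (hkc.clm_apply (by fun_prop)).add (hk'c.clm_apply (by fun_prop))
    rw [← uIcc_of_le hab] at hi1 hi2
    have h0 := intervalIntegral.integral_eq_sub_of_hasDerivAt hB hi2.intervalIntegrable
    simp only [ha, hb, Prod.mk_zero_zero, map_zero, sub_zero] at h0
    rw [← sub_zero (∫ t in a..b, k t (η t, deriv η t)), ← h0,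
      ← intervalIntegral.integral_sub hi1.intervalIntegrable hi2.intervalIntegrable]
    refine intervalIntegral.integral_congr fun t _ => ?_
    have hsplit : k t (η t, deriv η t) = k t (η t, 0) + k t (0, deriv η t) := by
      rw [← map_add]; simp
    simp only [he, _root_.sub_apply, ContinuousLinearMap.comp_apply,
      ContinuousLinearMap.inl_apply, ContinuousLinearMap.inr_apply, hsplit]
    ring
  have hvar := fun η hη => hasDerivAt_action hΩ hL hab hc (η := η) hη hcΩ
  have hkv : ∀ t ∈ Icc a b, ∀ v, HasDerivAt (fun τ => k τ (0, v)) (deriv k t (0, v)) t :=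
    fun t ht v => by simpa using (hkd t ht).clm_apply (hasDerivAt_const t ((0 : E), v))
  constructor
  · intro H t ht v
    have h := eq_zero_of_forall_integral_eq_zero hab hec (fun η hη ha hb => by
      rw [← hparts η hη ha hb]
      exact (hvar η hη).unique (H η hη ha hb)) t ht
    have h2 := hkv t (Ioo_subset_Icc_self ht) v
    have h3 : k t (v, 0) - deriv k t (0, v) = 0 := by
      simpa [he] using DFunLike.congr_fun h v
    rwa [show deriv k t (0, v) = k t (v, 0) by linarith] at h2
  · intro H η hη ha hb
    have h := hvar η hη
    rw [show (∫ t in a..b, fderiv ℝ L (c t, deriv c t) (η t, deriv η t)) = 0 from ?_] at h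
    · exact h
    rw [hparts η hη ha hb, intervalIntegral.integral_of_le hab, integral_Ioc_eq_integral_Ioo,
      setIntegral_congr_fun (g := fun _ => (0 : ℝ)) measurableSet_Ioo, integral_zero]
    intro t ht
    have h2 := (hkv t (Ioo_subset_Icc_self ht) (η t)).unique (H t ht (η t))
    change deriv k t (0, η t) = k t (η t, 0) at h2
    simp [he, h2]

end EulerLagrange

/-! ### The Euler–Lagrange equations of the two metrics -/

section Lagrangians

variable {E : Type*} [NormedAddCommGroup E] [NormedSpace ℝ E]

/-- The Christoffel symbols of the first kind `h_sr γʳ_ij uⁱ vʲ wˢ` of a metric on a normed space. -/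
def christoffelForm (g : E → E →L[ℝ] E →L[ℝ] ℝ) (x u v w : E) : ℝ :=
  (fderiv ℝ g x u v w + fderiv ℝ g x v u w - fderiv ℝ g x w u v) / 2

/-- The covariant derivative `w_{i||j} vⁱ uʲ` of the 1-form that corresponds under the metric to a
vector field with value `X` at `x`. -/
def covDerivForm (g : E → E →L[ℝ] E →L[ℝ] ℝ) (w : E → E →L[ℝ] ℝ) (x X v u : E) : ℝ :=
  fderiv ℝ w x u v - christoffelForm g x v u X

/-- The 1-form dual to the covariant acceleration `c̈ + γ(ċ, ċ)` of a curve with position `x`,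
velocity `y` and second coordinate derivative `a`, evaluated at `v`. -/
def accelForm (g : E → E →L[ℝ] E →L[ℝ] ℝ) (x y a v : E) : ℝ :=
  christoffelForm g x y y v + g x a v

variable {g : E → E →L[ℝ] E →L[ℝ] ℝ} {w : E → E →L[ℝ] ℝ}

theorem hasFDerivAt_apply_bilin {x v w : E} (hg : DifferentiableAt ℝ g x) :
    HasFDerivAt (fun z => g z v w) (((fderiv ℝ g x).flip v).flip w) x := by
  have := (hg.hasFDerivAt.clm_apply (hasFDerivAt_const v x)).clm_apply (hasFDerivAt_const w x)
  refine this.congr_fderiv ?_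
  ext u
  simp

theorem fderiv_bilin_symm (hsymm : ∀ x u v, g x u v = g x v u) {x : E}
    (hg : DifferentiableAt ℝ g x) (u v w : E) : fderiv ℝ g x u v w = fderiv ℝ g x u w v := by
  have h1 := hasFDerivAt_apply_bilin (v := v) (w := w) hg
  simp only [fun z => hsymm z v w] at h1
  simpa using DFunLike.congr_fun (h1.unique (hasFDerivAt_apply_bilin hg)) u

theorem exists_hasFDerivAt_quadratic {x y : E} (hg : DifferentiableAt ℝ g x) :
    ∃ D : E × E →L[ℝ] ℝ, HasFDerivAt (fun z : E × E => g z.1 z.2 z.2) D (x, y) ∧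
      ∀ v v', D (v, v') = fderiv ℝ g x v y y + g x v' y + g x y v' := by
  have h1 : HasFDerivAt (fun z : E × E => g z.1) _ (x, y) :=
    HasFDerivAt.comp (x, y) (g := g) (f := Prod.fst) hg.hasFDerivAt
      (hasFDerivAt_fst (𝕜 := ℝ) (p := (x, y)))
  have h2 := hasFDerivAt_snd (𝕜 := ℝ) (p := (x, y))
  refine ⟨_, (h1.clm_apply h2).clm_apply h2, fun v v' => ?_⟩
  simp
  ring

theorem exists_hasFDerivAt_linear {x y : E} (hw : DifferentiableAt ℝ w x) :
    ∃ D : E × E →L[ℝ] ℝ, HasFDerivAt (fun z : E × E => w z.1 z.2) D (x, y) ∧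
      ∀ v v', D (v, v') = fderiv ℝ w x v y + w x v' := by
  have h1 : HasFDerivAt (fun z : E × E => w z.1) _ (x, y) :=
    HasFDerivAt.comp (x, y) (g := w) (f := Prod.fst) hw.hasFDerivAt
      (hasFDerivAt_fst (𝕜 := ℝ) (p := (x, y)))
  have h2 := hasFDerivAt_snd (𝕜 := ℝ) (p := (x, y))
  refine ⟨_, h1.clm_apply h2, fun v v' => ?_⟩
  simp
  ring

theorem fderiv_riemLagrangian (hsymm : ∀ x u v, g x u v = g x v u) {x y : E}
    (hg : DifferentiableAt ℝ g x) (hN : 0 < g x y y) (v v' : E) :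
    fderiv ℝ (fun z : E × E => √(g z.1 z.2 z.2)) (x, y) (v, v') =
      (fderiv ℝ g x v y y / 2 + g x y v') / √(g x y y) := by
  obtain ⟨D, hD, hDv⟩ := exists_hasFDerivAt_quadratic (y := y) hg
  rw [(hD.sqrt hN.ne').fderiv]
  simp only [_root_.smul_apply, hDv, hsymm x v' y, smul_eq_mul]
  field_simp
  ring

theorem fderiv_kropinaLagrangian (hsymm : ∀ x u v, g x u v = g x v u) {x y : E}
    (hg : DifferentiableAt ℝ g x) (hw : DifferentiableAt ℝ w x) (hω : 0 < w x y) (v v' : E) :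
    fderiv ℝ (fun z : E × E => g z.1 z.2 z.2 / (2 * w z.1 z.2)) (x, y) (v, v') =
      (fderiv ℝ g x v y y / 2 + g x y v') / w x y
        - g x y y * (fderiv ℝ w x v y + w x v') / (2 * w x y ^ 2) := by
  obtain ⟨D, hD, hDv⟩ := exists_hasFDerivAt_quadratic (y := y) hg
  obtain ⟨D', hD', hDv'⟩ := exists_hasFDerivAt_linear (y := y) hw
  have h := hD.fun_mul ((hasDerivAt_inv (mul_pos two_pos hω).ne').comp_hasFDerivAt (x, y)
    (hD'.const_mul 2))
  simp only [Function.comp_def, ← div_eq_mul_inv] at h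
  rw [h.fderiv]
  simp [hDv, hDv', hsymm x v' y]
  field_simp
  ring

variable {c : ℝ → E} {t : ℝ}

theorem hasDerivAt_bilin_curve {y z : ℝ → E} {y' z' : E} (hg : DifferentiableAt ℝ g (c t))
    (hc : DifferentiableAt ℝ c t) (hy : HasDerivAt y y' t) (hz : HasDerivAt z z' t) :
    HasDerivAt (fun τ => g (c τ) (y τ) (z τ))
      (fderiv ℝ g (c t) (deriv c t) (y t) (z t) + g (c t) y' (z t) + g (c t) (y t) z') t := by
  have h : HasDerivAt (fun τ => g (c τ)) (fderiv ℝ g (c t) (deriv c t)) t :=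
    HasFDerivAt.comp_hasDerivAt t (l := g) hg.hasFDerivAt hc.hasDerivAt
  exact ((h.clm_apply hy).clm_apply hz).congr_deriv (by simp)

theorem hasDerivAt_linear_curve {y : ℝ → E} {y' : E} (hw : DifferentiableAt ℝ w (c t))
    (hc : DifferentiableAt ℝ c t) (hy : HasDerivAt y y' t) :
    HasDerivAt (fun τ => w (c τ) (y τ))
      (fderiv ℝ w (c t) (deriv c t) (y t) + w (c t) y') t := by
  have h : HasDerivAt (fun τ => w (c τ)) (fderiv ℝ w (c t) (deriv c t)) t :=
    hw.hasFDerivAt.comp_hasDerivAt t hc.hasDerivAt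
  exact h.clm_apply hy

/-- The Euler–Lagrange equation of a Riemannian metric: the covariant acceleration is proportional
to the velocity. -/
theorem eulerLagrange_riem_iff (hsymm : ∀ x u v, g x u v = g x v u) {U : Set E} (hU : IsOpen U)
    (hg : DifferentiableOn ℝ g U) (hc : ContDiff ℝ ∞ c) (hct : c t ∈ U)
    (hN : 0 < g (c t) (deriv c t) (deriv c t)) (v : E) :
    HasDerivAt (fun τ => fderiv ℝ (fun z : E × E => √(g z.1 z.2 z.2)) (c τ, deriv c τ) (0, v))
      (fderiv ℝ (fun z : E × E => √(g z.1 z.2 z.2)) (c t, deriv c t) (v, 0)) t ↔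
    g (c t) (deriv c t) (deriv c t) * accelForm g (c t) (deriv c t) (deriv (deriv c) t) v =
      accelForm g (c t) (deriv c t) (deriv (deriv c) t) (deriv c t) * g (c t) (deriv c t) v := by
  have hgx : ∀ x ∈ U, DifferentiableAt ℝ g x := fun x hx => hg.differentiableAt (hU.mem_nhds hx)
  have hc1 : ContDiff ℝ ∞ (deriv c) := (contDiff_infty_iff_deriv.1 hc).2
  have hcd : DifferentiableAt ℝ c t := hc.differentiable (by simp) t
  have hcd1 : HasDerivAt (deriv c) (deriv (deriv c) t) t :=
    (hc1.differentiable (by simp) t).hasDerivAt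
  have hNd := hasDerivAt_bilin_curve (hgx _ hct) hcd hcd1 hcd1
  have hpd := hasDerivAt_bilin_curve (hgx _ hct) hcd hcd1 (hasDerivAt_const t v)
  have hd := hpd.fun_div (hNd.sqrt hN.ne') (Real.sqrt_pos.2 hN).ne'
  have hev : (fun τ => fderiv ℝ (fun z : E × E => √(g z.1 z.2 z.2)) (c τ, deriv c τ) (0, v))
      =ᶠ[𝓝 t] fun τ => g (c τ) (deriv c τ) v / √(g (c τ) (deriv c τ) (deriv c τ)) := by
    filter_upwards [hc.continuous.continuousAt.preimage_mem_nhds (hU.mem_nhds hct),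
      hNd.continuousAt.eventually_mem (Ioi_mem_nhds hN)] with τ h1 h2
    rw [fderiv_riemLagrangian hsymm (hgx _ h1) h2]
    simp
  rw [hev.hasDerivAt_iff, fderiv_riemLagrangian hsymm (hgx _ hct) hN,
    show ∀ e : ℝ, HasDerivAt _ e t ↔ _ = e from fun e => ⟨hd.unique, fun h => h ▸ hd⟩]
  have hs := Real.sq_sqrt hN.le
  have hsp := Real.sqrt_pos.2 hN
  simp only [accelForm, christoffelForm, map_zero, hsymm (c t) (deriv c t) (deriv (deriv c) t)]
  generalize √(g (c t) (deriv c t) (deriv c t)) = r at *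
  rw [← hs]
  generalize fderiv ℝ g (c t) (deriv c t) (deriv c t) v = A
  generalize fderiv ℝ g (c t) (deriv c t) (deriv c t) (deriv c t) = B
  generalize fderiv ℝ g (c t) v (deriv c t) (deriv c t) = C
  generalize g (c t) (deriv (deriv c) t) v = D
  generalize g (c t) (deriv (deriv c) t) (deriv c t) = F
  generalize g (c t) (deriv c t) v = G
  rw [div_eq_div_iff (by positivity) (by positivity)]
  field_simp
  constructor <;> intro h
  · linear_combination h
  · linear_combination h

/-- The Euler–Lagrange equation of the Kropina metric of a unit Killing field, multiplied by the
third power of `w(ċ)`. -/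
theorem eulerLagrange_kropina_iff (hsymm : ∀ x u v, g x u v = g x v u) {U : Set E} (hU : IsOpen U)
    (hg : DifferentiableOn ℝ g U) (hw : DifferentiableOn ℝ w U) (hc : ContDiff ℝ ∞ c)
    (hct : c t ∈ U) (hω : 0 < w (c t) (deriv c t)) {X : E} (hX : ∀ u, w (c t) u = g (c t) X u)
    (hK : ∀ u v, covDerivForm g w (c t) X u v + covDerivForm g w (c t) X v u = 0) (v : E) :
    HasDerivAt
      (fun τ => fderiv ℝ (fun z : E × E => g z.1 z.2 z.2 / (2 * w z.1 z.2)) (c τ, deriv c τ) (0, v))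
      (fderiv ℝ (fun z : E × E => g z.1 z.2 z.2 / (2 * w z.1 z.2)) (c t, deriv c t) (v, 0)) t ↔
    w (c t) (deriv c t) ^ 2 * accelForm g (c t) (deriv c t) (deriv (deriv c) t) v
      - w (c t) (deriv c t) * g (c t) (deriv c t) v *
        accelForm g (c t) (deriv c t) (deriv (deriv c) t) X
      - w (c t) (deriv c t) * w (c t) v *
        accelForm g (c t) (deriv c t) (deriv (deriv c) t) (deriv c t)
      + g (c t) (deriv c t) (deriv c t) * w (c t) v *
        accelForm g (c t) (deriv c t) (deriv (deriv c) t) X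
      = g (c t) (deriv c t) (deriv c t) * w (c t) (deriv c t) *
        covDerivForm g w (c t) X v (deriv c t) := by
  have hgx : ∀ x ∈ U, DifferentiableAt ℝ g x := fun x hx => hg.differentiableAt (hU.mem_nhds hx)
  have hwx : ∀ x ∈ U, DifferentiableAt ℝ w x := fun x hx => hw.differentiableAt (hU.mem_nhds hx)
  have hc1 : ContDiff ℝ ∞ (deriv c) := (contDiff_infty_iff_deriv.1 hc).2
  have hcd : DifferentiableAt ℝ c t := hc.differentiable (by simp) t
  have hcd1 : HasDerivAt (deriv c) (deriv (deriv c) t) t :=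
    (hc1.differentiable (by simp) t).hasDerivAt
  have hNd := hasDerivAt_bilin_curve (hgx _ hct) hcd hcd1 hcd1
  have hpd := hasDerivAt_bilin_curve (hgx _ hct) hcd hcd1 (hasDerivAt_const t v)
  have hωd := hasDerivAt_linear_curve (hwx _ hct) hcd hcd1
  have hwd := hasDerivAt_linear_curve (hwx _ hct) hcd (hasDerivAt_const t v)
  have hd := (hpd.fun_div hωd hω.ne').fun_sub
    ((hNd.fun_mul hwd).fun_div ((hωd.fun_pow 2).const_mul 2) (by positivity))
  have hev : (fun τ => fderiv ℝ (fun z : E × E => g z.1 z.2 z.2 / (2 * w z.1 z.2))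
        (c τ, deriv c τ) (0, v)) =ᶠ[𝓝 t]
      fun τ => g (c τ) (deriv c τ) v / w (c τ) (deriv c τ)
        - g (c τ) (deriv c τ) (deriv c τ) * w (c τ) v / (2 * w (c τ) (deriv c τ) ^ 2) := by
    filter_upwards [hc.continuous.continuousAt.preimage_mem_nhds (hU.mem_nhds hct),
      hωd.continuousAt.eventually_mem (Ioi_mem_nhds hω)] with τ h1 h2
    rw [fderiv_kropinaLagrangian hsymm (hgx _ h1) (hwx _ h1) h2]
    simp
  rw [hev.hasDerivAt_iff, fderiv_kropinaLagrangian hsymm (hgx _ hct) (hwx _ hct) hω,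
    show ∀ e : ℝ, HasDerivAt _ e t ↔ _ = e from fun e => ⟨hd.unique, fun h => h ▸ hd⟩]
  have hK1 := hK (deriv c t) (deriv c t)
  have hK2 := hK (deriv c t) v
  simp only [covDerivForm, christoffelForm] at hK1 hK2
  simp only [accelForm, christoffelForm, covDerivForm, map_zero, add_zero,
    hsymm (c t) (deriv c t) (deriv (deriv c) t), hX (deriv (deriv c) t),
    hsymm (c t) X (deriv (deriv c) t)]
  rw [fderiv_bilin_symm hsymm (hgx _ hct) X v (deriv c t)] at *
  generalize w (c t) (deriv c t) = om at *
  generalize w (c t) v = wv at *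
  generalize g (c t) (deriv (deriv c) t) v = D at *
  generalize g (c t) (deriv (deriv c) t) (deriv c t) = F at *
  generalize g (c t) (deriv (deriv c) t) X = K at *
  generalize g (c t) (deriv c t) (deriv c t) = N at *
  generalize g (c t) (deriv c t) v = G at *
  generalize fderiv ℝ g (c t) (deriv c t) (deriv c t) v = a1 at *
  generalize fderiv ℝ g (c t) (deriv c t) (deriv c t) (deriv c t) = a2 at *
  generalize fderiv ℝ g (c t) v (deriv c t) (deriv c t) = a3 at *
  generalize fderiv ℝ g (c t) (deriv c t) (deriv c t) X = a4 at *
  generalize fderiv ℝ g (c t) X (deriv c t) (deriv c t) = a5 at *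
  generalize fderiv ℝ g (c t) (deriv c t) v X = a6 at *
  generalize fderiv ℝ g (c t) v (deriv c t) X = a7 at *
  generalize fderiv ℝ g (c t) X (deriv c t) v = a8 at *
  generalize fderiv ℝ w (c t) (deriv c t) (deriv c t) = b1 at *
  generalize fderiv ℝ w (c t) v (deriv c t) = b2 at *
  generalize fderiv ℝ w (c t) (deriv c t) v = b3 at *
  obtain rfl : b1 = (a4 + a4 - a5) / 2 := by linarith
  obtain rfl : b2 = (a6 + a7 - a8) - b3 := by linarith
  rw [← sub_eq_zero, ← sub_eq_zero (b := N * om * _)]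
  have key : ∀ P Q : ℝ, Q = om ^ 3 * P → (P = 0 ↔ Q = 0) := fun P Q h => by
    rw [h]; simp [hω.ne']
  apply key
  field_simp
  ring

end Lagrangians

/-! ### Pointwise algebra of the Kropina Euler–Lagrange equation -/

section Algebra

variable {E : Type*} [NormedAddCommGroup E] [NormedSpace ℝ E]
  {g : E → E →L[ℝ] E →L[ℝ] ℝ} {w : E → E →L[ℝ] ℝ} {x X : E}

/-- For a parallel field, the Kropina Euler–Lagrange equation says that the covariant acceleration
`Γ` is proportional to the velocity `y`. -/
theorem kropina_equation_iff_of_parallel (hsymm : ∀ x u v, g x u v = g x v u)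
    (hX : ∀ u, w x u = g x X u) (hX1 : w x X = 1) {y : E} (hN : 0 < g x y y) (hω : 0 < w x y)
    (Γ : E → ℝ) :
    (∀ v, w x y ^ 2 * Γ v - w x y * g x y v * Γ X - w x y * w x v * Γ y
      + g x y y * w x v * Γ X = 0) ↔
    ∀ v, g x y y * Γ v = Γ y * g x y v := by
  have hyX : g x y X = w x y := by rw [hX, hsymm]
  constructor
  · intro h v
    have h1 := h X
    rw [hyX, hX1] at h1
    have h2 : g x y y * Γ X = w x y * Γ y := by linear_combination h1
    have h3 := h v
    have h4 : w x y ^ 2 * (g x y y * Γ v - Γ y * g x y v) = 0 := by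
      linear_combination g x y y * h3 + (w x y * g x y v - g x y y * w x v) * h2
    rcases mul_eq_zero.1 h4 with h5 | h5
    · exact absurd h5 (by positivity)
    · linarith
  · intro h v
    have h1 := h X
    rw [hyX] at h1
    have h4 : g x y y * (w x y ^ 2 * Γ v - w x y * g x y v * Γ X - w x y * w x v * Γ y
      + g x y y * w x v * Γ X) = 0 := by
      linear_combination w x y ^ 2 * h v + (g x y y * w x v - w x y * g x y v) * h1
    exact (mul_eq_zero.1 h4).resolve_left hN.ne'

theorem christoffelForm_continuous (x v : E) :
    Continuous fun y => christoffelForm g x y y v := by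
  unfold christoffelForm
  fun_prop

theorem christoffelForm_continuous_diag (x : E) :
    Continuous fun y => christoffelForm g x y y y := by
  unfold christoffelForm
  fun_prop

theorem covDerivForm_add_smul (x X v u u' : E) (r : ℝ) :
    covDerivForm g w x X v (u + r • u') =
      covDerivForm g w x X v u + r * covDerivForm g w x X v u' := by
  simp [covDerivForm, christoffelForm]
  ring

theorem covDerivForm_continuous (x X v : E) : Continuous fun u => covDerivForm g w x X v u := by
  unfold covDerivForm christoffelForm
  fun_prop

/-- A continuous function vanishing on the half-space `w > 0` also vanishes on its boundary. -/
theorem eq_zero_of_forall_pos {f : E → ℝ} (hf : Continuous f) (l : E →L[ℝ] ℝ) (hX1 : l X = 1)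
    (h : ∀ y, 0 < l y → f y = 0) {z : E} (hz : l z = 0) : f z = 0 := by
  have h1 : Tendsto (fun ε : ℝ => f (z + ε • X)) (𝓝[>] 0) (𝓝 (f z)) := by
    have : Continuous fun ε : ℝ => f (z + ε • X) := by fun_prop
    simpa using this.tendsto 0 |>.mono_left nhdsWithin_le_nhds
  refine tendsto_nhds_unique h1 (tendsto_const_nhds.congr' ?_)
  filter_upwards [self_mem_nhdsWithin] with ε hε
  exact (h _ (by simpa [hz, hX1] using hε)).symm

/-- If all straight lines through `x` in admissible directions solve the Kropina Euler–Lagrange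
equation, then the field is parallel at `x` and the straight lines are geodesics up to
parametrization. The equation is polynomial in the direction `y`, and its restriction to the
boundary hyperplane `w(y) = 0` isolates the covariant derivative of `w`. -/
theorem parallel_and_geodesic_of_kropina_equation (hsymm : ∀ x u v, g x u v = g x v u)
    (hpos : ∀ y, y ≠ 0 → 0 < g x y y) (hX : ∀ u, w x u = g x X u) (hX1 : w x X = 1)
    (hK : ∀ u v, covDerivForm g w x X u v + covDerivForm g w x X v u = 0)
    (hXcov : ∀ u, covDerivForm g w x X X u = 0)
    (h : ∀ y, 0 < w x y → ∀ v,
      w x y ^ 2 * christoffelForm g x y y v - w x y * g x y v * christoffelForm g x y y X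
        - w x y * w x v * christoffelForm g x y y y + g x y y * w x v * christoffelForm g x y y X
        = g x y y * w x y * covDerivForm g w x X v y) :
    (∀ v u, covDerivForm g w x X v u = 0) ∧
      ∀ y v, g x y y * christoffelForm g x y y v = christoffelForm g x y y y * g x y v := by
  have hyX : ∀ y, g x y X = w x y := fun y => by rw [hX, hsymm]
  have h1 : ∀ y, 0 < w x y →
      g x y y * christoffelForm g x y y X - w x y * christoffelForm g x y y y = 0 := by
    intro y hy
    have h2 := h y hy X
    rw [hyX, hX1, hXcov] at h2
    linear_combination h2
  have h2 : ∀ v y, 0 < w x y → w x y * christoffelForm g x y y v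
      - g x y v * christoffelForm g x y y X - g x y y * covDerivForm g w x X v y = 0 := by
    intro v y hy
    have h3 : w x y * (w x y * christoffelForm g x y y v - g x y v * christoffelForm g x y y X
        - g x y y * covDerivForm g w x X v y) = 0 := by
      linear_combination h y hy v - w x v * h1 y hy
    exact (mul_eq_zero.1 h3).resolve_left hy.ne'
  have hc1 := fun v => christoffelForm_continuous (g := g) x v
  have hc2 := christoffelForm_continuous_diag (g := g) x
  have hc3 := fun v => covDerivForm_continuous (g := g) (w := w) x X v
  have hker : ∀ v z, w x z = 0 → covDerivForm g w x X v z = 0 := by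
    intro v z hz
    rcases eq_or_ne z 0 with rfl | hz0
    · simp [covDerivForm, christoffelForm]
    have e1 := eq_zero_of_forall_pos (by have := hc1 X; fun_prop) (w x) hX1 h1 hz
    have e2 := eq_zero_of_forall_pos (by have := hc1 X; have := hc1 v; have := hc3 v; fun_prop)
      (w x) hX1 (h2 v) hz
    rw [hz, zero_mul, sub_zero] at e1
    rw [(mul_eq_zero.1 e1).resolve_left (hpos z hz0).ne', hz] at e2
    have e3 : g x z z * covDerivForm g w x X v z = 0 := by linarith
    exact (mul_eq_zero.1 e3).resolve_left (hpos z hz0).ne'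
  have hcov : ∀ v u, covDerivForm g w x X v u = 0 := by
    intro v u
    have e := covDerivForm_add_smul (g := g) (w := w) x X v (u - w x u • X) X (w x u)
    rw [sub_add_cancel, hker v (u - w x u • X) (by simp [hX1])] at e
    have e2 := hK v X
    rw [hXcov] at e2
    rw [e, show covDerivForm g w x X v X = 0 by linarith]
    simp
  have h3 : ∀ y, 0 < w x y → ∀ v,
      g x y y * christoffelForm g x y y v - christoffelForm g x y y y * g x y v = 0 := by
    intro y hy v
    have hN : 0 < g x y y := hpos y fun h0 => by simp [h0] at hy
    have := (kropina_equation_iff_of_parallel hsymm hX hX1 hN hy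
      fun v => christoffelForm g x y y v).1 (fun v => by rw [h y hy v, hcov, mul_zero]) v
    linarith
  refine ⟨hcov, fun y v => sub_eq_zero.1 ?_⟩
  rcases lt_trichotomy (w x y) 0 with hy | hy | hy
  · have := h3 (-y) (by simpa using hy) v
    simp only [christoffelForm, map_neg, _root_.neg_apply, neg_neg] at this ⊢
    linarith
  · exact eq_zero_of_forall_pos (by have := hc1 v; fun_prop) (w x) hX1 (fun y hy => h3 y hy v) hy
  · exact h3 y hy v

/-- The covariant derivative of a unit field is orthogonal to the field. The point `x` maximizes
`z ↦ 2 w_z(X) - g_z(X, X)`, which by the Cauchy–Schwarz inequality is at most `1`. -/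
theorem covDerivForm_self_eq_zero (hsymm : ∀ x u v, g x u v = g x v u)
    (hg : DifferentiableAt ℝ g x) (hw : DifferentiableAt ℝ w x)
    (hmax : ∀ᶠ z in 𝓝 x, 2 * w z X - g z X X ≤ 2 * w x X - g x X X) (u : E) :
    covDerivForm g w x X X u = 0 := by
  have h1 : HasFDerivAt (fun z => 2 * w z X - g z X X) _ x :=
    ((hw.hasFDerivAt.clm_apply (hasFDerivAt_const X x)).const_mul 2).sub
      (hasFDerivAt_apply_bilin (v := X) (w := X) hg)
  have h2 := DFunLike.congr_fun (IsLocalMax.hasFDerivAt_eq_zero (f := fun z => 2 * w z X - g z X X)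
    hmax h1) u
  simp at h2
  have h3 := fderiv_bilin_symm hsymm hg X u X
  simp only [covDerivForm, christoffelForm]
  linarith

end Algebra

/-! ### Straight lines -/

section Lines

variable {E : Type*} [NormedAddCommGroup E] [InnerProductSpace ℝ E]

/-- A regular curve runs along a straight line if and only if its acceleration is everywhere
proportional to its velocity. -/
theorem collinear_image_iff {c : ℝ → E} (hc : ContDiff ℝ ∞ c) {a b : ℝ} (hab : a < b)
    (hreg : ∀ t ∈ Icc a b, deriv c t ≠ 0) :
    Collinear ℝ (c '' Icc a b) ↔ ∀ t ∈ Ioo a b, ∃ r : ℝ, deriv (deriv c) t = r • deriv c t := by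
  have hc1 : ContDiff ℝ ∞ (deriv c) := (contDiff_infty_iff_deriv.1 hc).2
  have hd : Differentiable ℝ c := hc.differentiable (by simp)
  have hd1 : Differentiable ℝ (deriv c) := hc1.differentiable (by simp)
  constructor
  · intro h t ht
    obtain ⟨p, v, hpv⟩ := (collinear_iff_exists_forall_eq_smul_vadd (k := ℝ) _).1 h
    have hline : ∀ s ∈ Ioo a b, ∃ r : ℝ, c s = r • v + p := fun s hs => by
      simpa using hpv (c s) (mem_image_of_mem c (Ioo_subset_Icc_self hs))
    -- The difference quotients of a curve in an affine line of direction `v` are multiples of `v`,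
    -- hence so is its derivative.
    have hcomp : ∀ f : ℝ → E, Differentiable ℝ f → ∀ q : E,
        (∀ s ∈ Ioo a b, ∃ r : ℝ, f s = r • v + q) →
        ∀ s ∈ Ioo a b, ∃ r : ℝ, deriv f s = r • v := by
      intro f hf q hq s hs
      have hclosed : IsClosed ((ℝ ∙ v : Submodule ℝ E) : Set E) :=
        Submodule.closed_of_finiteDimensional _
      have hmem : deriv f s ∈ (ℝ ∙ v : Submodule ℝ E) := by
        have ht := (hf s).hasDerivAt.tendsto_slope.mono_left
          (nhdsWithin_mono s fun y (hy : y ∈ Ioi s) => ne_of_gt hy)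
        refine hclosed.mem_of_tendsto ht ?_
        filter_upwards [Ioo_mem_nhdsGT hs.2] with y hy
        obtain ⟨r1, h1⟩ := hq y ⟨hs.1.trans hy.1, hy.2⟩
        obtain ⟨r2, h2⟩ := hq s hs
        refine Submodule.mem_span_singleton.2 ⟨(y - s)⁻¹ * (r1 - r2), ?_⟩
        rw [slope_def_module, h1, h2]
        module
      obtain ⟨r, hr⟩ := Submodule.mem_span_singleton.1 hmem
      exact ⟨r, hr.symm⟩
    have h1 := hcomp c hd p hline
    obtain ⟨r, hr⟩ := h1 t ht
    obtain ⟨r', hr'⟩ := hcomp (deriv c) hd1 0 (by simpa using h1) t ht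
    have hr0 : r ≠ 0 := by
      rintro rfl
      exact hreg t (Ioo_subset_Icc_self ht) (by simpa using hr)
    exact ⟨r' / r, by rw [hr', hr, smul_smul, div_mul_cancel₀ _ hr0]⟩
  · intro h
    -- The unit tangent is constant.
    have hunit : ∃ e : E, ‖e‖ = 1 ∧ ∀ t ∈ Ioo a b, deriv c t = ‖deriv c t‖ • e := by
      have hm : (a + b) / 2 ∈ Ioo a b := ⟨by linarith, by linarith⟩
      have hder : ∀ t ∈ Ioo a b, HasDerivAt (fun t => ‖deriv c t‖⁻¹ • deriv c t) 0 t := by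
        intro t ht
        have hne := hreg t (Ioo_subset_Icc_self ht)
        have hn := norm_pos_iff.2 hne
        obtain ⟨r, hr⟩ := h t ht
        have h1 := ((hd1 t).hasDerivAt.norm_sq.sqrt (by positivity)).inv (by positivity)
        have h2 := h1.smul (hd1 t).hasDerivAt
        simp only [Real.sqrt_sq (norm_nonneg _)] at h2
        have h3 := h2.congr_deriv (g' := 0) (by
          simp only [hr, inner_smul_right, real_inner_self_eq_norm_sq, Pi.inv_apply,
            smul_smul, ← add_smul]
          convert zero_smul ℝ (deriv c t) using 2
          field_simp
          ring)
        exact h3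
      refine ⟨‖deriv c ((a + b) / 2)‖⁻¹ • deriv c ((a + b) / 2), ?_, fun t ht => ?_⟩
      · rw [norm_smul, norm_inv, norm_norm,
          inv_mul_cancel₀ (norm_ne_zero_iff.2 (hreg _ (Ioo_subset_Icc_self hm)))]
      · have := isOpen_Ioo.is_const_of_deriv_eq_zero isPreconnected_Ioo
          (fun s hs => (hder s hs).differentiableAt.differentiableWithinAt)
          (fun s hs => (hder s hs).deriv) ht hm
        rw [← this, smul_smul, mul_inv_cancel₀
          (norm_ne_zero_iff.2 (hreg t (Ioo_subset_Icc_self ht))), one_smul]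
    obtain ⟨e, he1, he⟩ := hunit
    have hder : ∀ t ∈ Ioo a b, HasDerivAt (fun t => c t - inner ℝ e (c t) • e) 0 t := by
      intro t ht
      refine ((hd t).hasDerivAt.sub
        (((hasDerivAt_const t e).inner ℝ (hd t).hasDerivAt).smul_const e)).congr_deriv ?_
      rw [he t ht, inner_smul_right, real_inner_self_eq_norm_sq, he1]
      simp
    have hm : (a + b) / 2 ∈ Ioo a b := ⟨by linarith, by linarith⟩
    have hconst : EqOn (fun t => c t - inner ℝ e (c t) • e)
        (fun _ => c ((a + b) / 2) - inner ℝ e (c ((a + b) / 2)) • e) (Ioo a b) := fun t ht =>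
      isOpen_Ioo.is_const_of_deriv_eq_zero isPreconnected_Ioo
        (fun s hs => (hder s hs).differentiableAt.differentiableWithinAt)
        (fun s hs => (hder s hs).deriv) ht hm
    have hclos := hconst.closure (by have := hc.continuous; fun_prop) continuous_const
    rw [closure_Ioo hab.ne] at hclos
    refine (collinear_iff_exists_forall_eq_smul_vadd (k := ℝ) _).2
      ⟨c ((a + b) / 2) - inner ℝ e (c ((a + b) / 2)) • e, e, ?_⟩
    rintro _ ⟨t, ht, rfl⟩
    refine ⟨inner ℝ e (c t), ?_⟩
    have := hclos ht
    simp only at this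
    rw [← this]
    simp

end Lines

/-! ### Rectilinear extremals in a coordinate domain -/

theorem isOpen_tangent_domain {E : Type*} [TopologicalSpace E] {U : Set E} {f : E × E → ℝ}
    (hU : IsOpen U) (hf : ContinuousOn f (U ×ˢ univ)) :
    IsOpen {z : E × E | z.1 ∈ U ∧ 0 < f z} := by
  have := hf.isOpen_inter_preimage (hU.prod isOpen_univ) (isOpen_Ioi (a := (0 : ℝ)))
  convert this using 1
  ext z
  simp

section Rectilinear

variable {E : Type*} [NormedAddCommGroup E] [InnerProductSpace ℝ E]
  {g : E → E →L[ℝ] E →L[ℝ] ℝ} {w : E → E →L[ℝ] ℝ} {U : Set E} {X : E → E}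

/-- Straight lines in `U` are, up to parametrization, geodesics of the metric `g`: the vector
`γ(y, y)` is proportional to `y`. The condition is stated with lowered indices. -/
def StraightLinesAreGeodesics (g : E → E →L[ℝ] E →L[ℝ] ℝ) (U : Set E) : Prop :=
  ∀ x ∈ U, ∀ y v, g x y y * christoffelForm g x y y v = christoffelForm g x y y y * g x y v

/-- If straight lines are geodesics, then a regular curve runs along a straight line if and only if
its covariant acceleration is proportional to its velocity. -/
theorem collinear_iff_accelForm (hpos : ∀ x ∈ U, ∀ y, y ≠ 0 → 0 < g x y y)
    (hgeo : StraightLinesAreGeodesics g U)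
    {a b : ℝ} (hab : a < b) {c : ℝ → E} (hc : ContDiff ℝ ∞ c)
    (hcU : ∀ t ∈ Icc a b, c t ∈ U ∧ deriv c t ≠ 0) :
    (∀ t ∈ Ioo a b, ∀ v, g (c t) (deriv c t) (deriv c t) *
        accelForm g (c t) (deriv c t) (deriv (deriv c) t) v =
      accelForm g (c t) (deriv c t) (deriv (deriv c) t) (deriv c t) * g (c t) (deriv c t) v) ↔
    Collinear ℝ (c '' Icc a b) := by
  rw [collinear_image_iff hc hab fun t ht => (hcU t ht).2]
  refine forall₂_congr fun t ht => ?_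
  obtain ⟨hU, h0⟩ := hcU t (Ioo_subset_Icc_self ht)
  have hN := hpos _ hU _ h0
  constructor
  · intro h
    refine ⟨g (c t) (deriv (deriv c) t) (deriv c t) / g (c t) (deriv c t) (deriv c t), ?_⟩
    by_contra hne
    set z := deriv (deriv c) t -
      (g (c t) (deriv (deriv c) t) (deriv c t) / g (c t) (deriv c t) (deriv c t)) • deriv c t
      with hz
    have hzpos := hpos _ hU z (sub_ne_zero.2 hne)
    have h1 := h z
    have h2 := hgeo _ hU (deriv c t) z
    simp only [accelForm] at h1
    have h3 : g (c t) z z = 0 := by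
      have e : g (c t) z z = g (c t) (deriv (deriv c) t) z -
          g (c t) (deriv (deriv c) t) (deriv c t) / g (c t) (deriv c t) (deriv c t) *
            g (c t) (deriv c t) z := by
        have e1 : g (c t) z = g (c t) (deriv (deriv c) t) -
            (g (c t) (deriv (deriv c) t) (deriv c t) / g (c t) (deriv c t) (deriv c t)) •
              g (c t) (deriv c t) := by
          rw [hz, map_sub, map_smul]
        rw [e1]
        simp
      rw [e]
      field_simp
      linarith
    exact hzpos.ne' h3
  · rintro ⟨r, hr⟩ v
    have h2 := hgeo _ hU (deriv c t) v
    simp only [accelForm, hr, map_smul, _root_.smul_apply, smul_eq_mul]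
    linear_combination h2

theorem contDiffOn_quadratic (hg : ContDiffOn ℝ ∞ g U) :
    ContDiffOn ℝ 2 (fun z : E × E => g z.1 z.2 z.2) (U ×ˢ univ) := by
  have h : ContDiffOn ℝ 2 (fun z : E × E => g z.1) (U ×ˢ univ) :=
    (show ContDiffOn ℝ 2 g U from mod_cast contDiffOn_infty.1 hg 2).comp contDiffOn_fst
      fun z hz => hz.1
  exact (h.clm_apply contDiffOn_snd).clm_apply contDiffOn_snd

theorem contDiffOn_linear (hw : ContDiffOn ℝ ∞ w U) :
    ContDiffOn ℝ 2 (fun z : E × E => w z.1 z.2) (U ×ˢ univ) := by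
  have h : ContDiffOn ℝ 2 (fun z : E × E => w z.1) (U ×ˢ univ) :=
    (show ContDiffOn ℝ 2 w U from mod_cast contDiffOn_infty.1 hw 2).comp contDiffOn_fst
      fun z hz => hz.1
  exact h.clm_apply contDiffOn_snd

theorem isCritical_riem_iff (hsymm : ∀ x u v, g x u v = g x v u) (hU : IsOpen U)
    (hg : ContDiffOn ℝ ∞ g U) (hpos : ∀ x ∈ U, ∀ y, y ≠ 0 → 0 < g x y y)
    {a b : ℝ} (hab : a ≤ b) {c : ℝ → E} (hc : ContDiff ℝ ∞ c)
    (hcU : ∀ t ∈ Icc a b, c t ∈ U ∧ deriv c t ≠ 0) :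
    IsCritical (fun z : E × E => √(g z.1 z.2 z.2)) a b c ↔
    ∀ t ∈ Ioo a b, ∀ v, g (c t) (deriv c t) (deriv c t) *
        accelForm g (c t) (deriv c t) (deriv (deriv c) t) v =
      accelForm g (c t) (deriv c t) (deriv (deriv c) t) (deriv c t) * g (c t) (deriv c t) v := by
  have hq := contDiffOn_quadratic hg
  have hL : ContDiffOn ℝ 2 (fun z : E × E => √(g z.1 z.2 z.2))
      {z : E × E | z.1 ∈ U ∧ 0 < g z.1 z.2 z.2} :=
    (hq.mono fun z hz => ⟨hz.1, mem_univ _⟩).sqrt fun z hz => hz.2.ne'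
  rw [isCritical_iff_eulerLagrange (isOpen_tangent_domain hU hq.continuousOn) hL hab hc
    fun t ht => ⟨(hcU t ht).1, hpos _ (hcU t ht).1 _ (hcU t ht).2⟩]
  refine forall₂_congr fun t ht => forall_congr' fun v => ?_
  obtain ⟨hct, h0⟩ := hcU t (Ioo_subset_Icc_self ht)
  exact eulerLagrange_riem_iff hsymm hU (hg.differentiableOn (by simp)) hc hct (hpos _ hct _ h0) v

theorem isCritical_kropina_iff (hsymm : ∀ x u v, g x u v = g x v u) (hU : IsOpen U)
    (hg : ContDiffOn ℝ ∞ g U) (hw : ContDiffOn ℝ ∞ w U)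
    (hX : ∀ x ∈ U, ∀ u, w x u = g x (X x) u)
    (hK : ∀ x ∈ U, ∀ u v, covDerivForm g w x (X x) u v + covDerivForm g w x (X x) v u = 0)
    {a b : ℝ} (hab : a ≤ b) {c : ℝ → E} (hc : ContDiff ℝ ∞ c)
    (hcU : ∀ t ∈ Icc a b, c t ∈ U ∧ 0 < w (c t) (deriv c t)) :
    IsCritical (fun z : E × E => g z.1 z.2 z.2 / (2 * w z.1 z.2)) a b c ↔
    ∀ t ∈ Ioo a b, ∀ v,
      w (c t) (deriv c t) ^ 2 * accelForm g (c t) (deriv c t) (deriv (deriv c) t) v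
      - w (c t) (deriv c t) * g (c t) (deriv c t) v *
        accelForm g (c t) (deriv c t) (deriv (deriv c) t) (X (c t))
      - w (c t) (deriv c t) * w (c t) v *
        accelForm g (c t) (deriv c t) (deriv (deriv c) t) (deriv c t)
      + g (c t) (deriv c t) (deriv c t) * w (c t) v *
        accelForm g (c t) (deriv c t) (deriv (deriv c) t) (X (c t))
      = g (c t) (deriv c t) (deriv c t) * w (c t) (deriv c t) *
        covDerivForm g w (c t) (X (c t)) v (deriv c t) := by
  have hq := contDiffOn_quadratic hg
  have hl := contDiffOn_linear hw
  have hsub : {z : E × E | z.1 ∈ U ∧ 0 < w z.1 z.2} ⊆ U ×ˢ univ := fun z hz => ⟨hz.1, mem_univ _⟩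
  have hL : ContDiffOn ℝ 2 (fun z : E × E => g z.1 z.2 z.2 / (2 * w z.1 z.2))
      {z : E × E | z.1 ∈ U ∧ 0 < w z.1 z.2} :=
    (hq.mono hsub).div (contDiffOn_const.mul (hl.mono hsub)) fun z hz => (mul_pos two_pos hz.2).ne'
  rw [isCritical_iff_eulerLagrange (isOpen_tangent_domain hU hl.continuousOn) hL hab hc hcU]
  refine forall₂_congr fun t ht => forall_congr' fun v => ?_
  obtain ⟨hct, h0⟩ := hcU t (Ioo_subset_Icc_self ht)
  exact eulerLagrange_kropina_iff hsymm hU (hg.differentiableOn (by simp))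
    (hw.differentiableOn (by simp)) hc hct h0 (hX _ hct) (hK _ hct) v

/-- Near each of its points, the straight line in an admissible direction is an admissible curve. -/
theorem exists_straight_line {Ω : Set (E × E)} {x y : E} (hΩ : IsOpen Ω) (hxy : (x, y) ∈ Ω) :
    ∃ (ε : ℝ) (c : ℝ → E), 0 < ε ∧ ContDiff ℝ ∞ c ∧ c 0 = x ∧ deriv c = (fun _ => y) ∧
      (∀ t ∈ Icc (-ε) ε, (c t, deriv c t) ∈ Ω) ∧ Collinear ℝ (c '' Icc (-ε) ε) := by
  have hd : deriv (fun t : ℝ => x + t • y) = fun _ => y := by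
    ext1 t
    simpa using (((hasDerivAt_id t).smul_const y).const_add x).deriv
  have hcont : Continuous fun t : ℝ => (x + t • y, y) := by fun_prop
  obtain ⟨ε, hε, hball⟩ := Metric.isOpen_iff.1 (hΩ.preimage hcont) 0 (by simpa using hxy)
  refine ⟨ε / 2, fun t => x + t • y, by positivity, by fun_prop, by simp, hd, fun t ht => ?_, ?_⟩
  · rw [hd]
    refine hball ?_
    rw [Metric.mem_ball, dist_zero_right, Real.norm_eq_abs, abs_lt]
    constructor <;> linarith [ht.1, ht.2]
  · refine (collinear_iff_exists_forall_eq_smul_vadd (k := ℝ) _).2 ⟨x, y, ?_⟩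
    rintro _ ⟨t, -, rfl⟩
    exact ⟨t, by rw [vadd_eq_add, add_comm]⟩

/-- The extremals of a Riemannian metric are rectilinear if and only if straight lines are
geodesics up to parametrization. -/
theorem riem_rectilinear_iff (hsymm : ∀ x u v, g x u v = g x v u) (hU : IsOpen U)
    (hg : ContDiffOn ℝ ∞ g U) (hpos : ∀ x ∈ U, ∀ y, y ≠ 0 → 0 < g x y y) :
    (∀ (a b : ℝ) (c : ℝ → E), a < b → ContDiff ℝ ∞ c →
      (∀ t ∈ Icc a b, c t ∈ U ∧ deriv c t ≠ 0) →
      (IsCritical (fun z : E × E => √(g z.1 z.2 z.2)) a b c ↔ Collinear ℝ (c '' Icc a b))) ↔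
    StraightLinesAreGeodesics g U := by
  constructor
  · intro H x hx y v
    rcases eq_or_ne y 0 with rfl | hy
    · simp [christoffelForm]
    obtain ⟨ε, c, hε, hc, hc0, hcd, hcΩ, hcol⟩ := exists_straight_line (x := x) (y := y)
      (hU.prod isOpen_compl_singleton) ⟨hx, hy⟩
    have h := (isCritical_riem_iff hsymm hU hg hpos (by linarith) hc hcΩ).1
      ((H _ _ c (by linarith) hc hcΩ).2 hcol) 0 ⟨by linarith, hε⟩ v
    simpa [hc0, hcd, accelForm] using h
  · intro H a b c hab hc hcU
    rw [isCritical_riem_iff hsymm hU hg hpos hab.le hc hcU]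
    exact collinear_iff_accelForm hpos H hab hc hcU

/-- The extremals of the Kropina metric of a unit Killing field are rectilinear if and only if the
field is parallel and straight lines are geodesics up to parametrization. -/
theorem kropina_rectilinear_iff (hsymm : ∀ x u v, g x u v = g x v u) (hU : IsOpen U)
    (hg : ContDiffOn ℝ ∞ g U) (hw : ContDiffOn ℝ ∞ w U)
    (hpos : ∀ x ∈ U, ∀ y, y ≠ 0 → 0 < g x y y)
    (hX : ∀ x ∈ U, ∀ u, w x u = g x (X x) u) (hX1 : ∀ x ∈ U, w x (X x) = 1)
    (hK : ∀ x ∈ U, ∀ u v, covDerivForm g w x (X x) u v + covDerivForm g w x (X x) v u = 0) :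
    (∀ (a b : ℝ) (c : ℝ → E), a < b → ContDiff ℝ ∞ c →
      (∀ t ∈ Icc a b, c t ∈ U ∧ 0 < w (c t) (deriv c t)) →
      (IsCritical (fun z : E × E => g z.1 z.2 z.2 / (2 * w z.1 z.2)) a b c ↔
        Collinear ℝ (c '' Icc a b))) ↔
    (∀ x ∈ U, ∀ v u, covDerivForm g w x (X x) v u = 0) ∧ StraightLinesAreGeodesics g U := by
  have hXcov : ∀ x ∈ U, ∀ u, covDerivForm g w x (X x) (X x) u = 0 := by
    intro x hx u
    refine covDerivForm_self_eq_zero hsymm ((hg.contDiffAt (hU.mem_nhds hx)).differentiableAt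
      (by simp)) ((hw.contDiffAt (hU.mem_nhds hx)).differentiableAt (by simp)) ?_ u
    filter_upwards [hU.mem_nhds hx] with z hz
    have h1 : 0 ≤ g z (X z - X x) (X z - X x) := by
      rcases eq_or_ne (X z - X x) 0 with h0 | h0
      · simp [h0]
      · exact (hpos z hz _ h0).le
    simp only [map_sub, _root_.sub_apply, ← hX z hz, hX1 z hz, hsymm z (X x) (X z)] at h1
    rw [hX1 x hx, ← hX x hx, hX1 x hx]
    linarith
  constructor
  · intro H
    have key : ∀ x ∈ U, _ := fun x hx =>
      parallel_and_geodesic_of_kropina_equation hsymm (hpos x hx) (hX x hx) (hX1 x hx) (hK x hx)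
        (hXcov x hx) (fun y hy v => by
          obtain ⟨ε, c, hε, hc, hc0, hcd, hcΩ, hcol⟩ := exists_straight_line (x := x) (y := y)
            (isOpen_tangent_domain hU (contDiffOn_linear hw).continuousOn) ⟨hx, hy⟩
          have h := (isCritical_kropina_iff hsymm hU hg hw hX hK (by linarith) hc hcΩ).1
            ((H _ _ c (by linarith) hc hcΩ).2 hcol) 0 ⟨by linarith, hε⟩ v
          simpa [hc0, hcd, accelForm] using h)
    exact ⟨fun x hx => (key x hx).1, fun x hx => (key x hx).2⟩
  · rintro ⟨hpar, hgeo⟩ a b c hab hc hcU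
    have hne : ∀ t ∈ Icc a b, c t ∈ U ∧ deriv c t ≠ 0 := fun t ht =>
      ⟨(hcU t ht).1, fun h0 => by simpa [h0] using (hcU t ht).2⟩
    rw [isCritical_kropina_iff hsymm hU hg hw hX hK hab.le hc hcU,
      ← collinear_iff_accelForm hpos hgeo hab hc hne]
    refine forall₂_congr fun t ht => ?_
    obtain ⟨hct, hω⟩ := hcU t (Ioo_subset_Icc_self ht)
    simp only [hpar _ hct, mul_zero]
    exact kropina_equation_iff_of_parallel hsymm (hX _ hct) (hX1 _ hct)
      (hpos _ hct _ (hne t (Ioo_subset_Icc_self ht)).2) hω _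

end Rectilinear

/-! ### The metric and the field in a chart -/

section Charts

variable {n : ℕ} {M : Type*} [TopologicalSpace M] [ChartedSpace (Coord n) M]
  {φ : OpenPartialHomeomorph M (Coord n)}

theorem mdifferentiable_of_mem_maximalAtlas
    (hφ : φ ∈ IsManifold.maximalAtlas (𝓡 n) ∞ M) : φ.MDifferentiable (𝓡 n) 𝓘(ℝ, Coord n) :=
  ⟨(contMDiffOn_of_mem_maximalAtlas hφ).mdifferentiableOn (by simp),
    (contMDiffOn_symm_of_mem_maximalAtlas hφ).mdifferentiableOn (by simp)⟩

theorem coordVec_coordField (W : (p : M) → TangentSpace (𝓡 n) p)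
    (hφ : φ ∈ IsManifold.maximalAtlas (𝓡 n) ∞ M) {x : Coord n}
    (hx : x ∈ φ.target) : coordVec φ x (coordField φ W x) = W (φ.symm x) := by
  have h1 := (mdifferentiable_of_mem_maximalAtlas hφ).symm_comp_deriv (φ.map_target hx)
  rw [φ.right_inv hx] at h1
  exact DFunLike.congr_fun h1 (W (φ.symm x))

theorem coordVec_ne_zero (hφ : φ ∈ IsManifold.maximalAtlas (𝓡 n) ∞ M) {x : Coord n}
    (hx : x ∈ φ.target) {y : Coord n} (hy : y ≠ 0) : coordVec φ x y ≠ 0 := fun h0 =>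
  hy ((mdifferentiable_of_mem_maximalAtlas hφ).symm.mfderiv_injective hx
    (h0.trans (map_zero _).symm))

variable [IsManifold (𝓡 n) ∞ M]

/-- The components of the metric in a chart, as a field of continuous bilinear forms. The tangent
spaces of `M` are identified with the model space, to which they are definitionally equal. -/
def chartMetric (h : RiemMetric n M) (φ : OpenPartialHomeomorph M (Coord n)) (x : Coord n) :
    Coord n →L[ℝ] Coord n →L[ℝ] ℝ :=
  let D : Coord n →L[ℝ] Coord n := mfderiv 𝓘(ℝ, Coord n) (𝓡 n) φ.symm x
  let B : Coord n →L[ℝ] Coord n →L[ℝ] ℝ := h.inner (φ.symm x)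
  B.bilinearComp D D

/-- The covariant components of a vector field in a chart, as a field of linear forms. -/
def chartForm (h : RiemMetric n M) (W : (p : M) → TangentSpace (𝓡 n) p)
    (φ : OpenPartialHomeomorph M (Coord n)) (x : Coord n) : Coord n →L[ℝ] ℝ :=
  (h.inner (φ.symm x) (W (φ.symm x))).comp (mfderiv 𝓘(ℝ, Coord n) (𝓡 n) φ.symm x)

variable (h : RiemMetric n M) (W : (p : M) → TangentSpace (𝓡 n) p)

theorem chartMetric_apply (x u v : Coord n) : chartMetric h φ x u v = metricCoord h φ x u v := rfl

theorem chartForm_apply (x v : Coord n) : chartForm h W φ x v = coField h W φ x v := rfl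

theorem contMDiffOn_coordVec (hφ : φ ∈ IsManifold.maximalAtlas (𝓡 n) ∞ M) (u : Coord n) :
    ContMDiffOn 𝓘(ℝ, Coord n) (𝓡 n).tangent ∞
      (fun x => (⟨φ.symm x, coordVec φ x u⟩ : TangentBundle (𝓡 n) M)) φ.target := by
  have h1 := (contMDiffOn_symm_of_mem_maximalAtlas hφ).contMDiffOn_tangentMapWithin (m := ∞)
    (by simp) φ.open_target.uniqueMDiffOn
  have h2 : ContMDiff 𝓘(ℝ, Coord n) 𝓘(ℝ, Coord n).tangent ∞
      (fun x => (⟨x, u⟩ : TangentBundle 𝓘(ℝ, Coord n) (Coord n))) :=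
    contMDiff_vectorSpace_iff_contDiff.2 contDiff_const
  refine (h1.comp h2.contMDiffOn fun x hx => hx).congr fun x hx => ?_
  simp only [Function.comp_def, tangentMapWithin, coordVec]
  rw [mfderivWithin_of_isOpen φ.open_target hx]

theorem contMDiffOn_inner (hφ : φ ∈ IsManifold.maximalAtlas (𝓡 n) ∞ M)
    {u v : (x : Coord n) → TangentSpace (𝓡 n) (φ.symm x)}
    (hu : ContMDiffOn 𝓘(ℝ, Coord n) (𝓡 n).tangent ∞
      (fun x => (⟨φ.symm x, u x⟩ : TangentBundle (𝓡 n) M)) φ.target)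
    (hv : ContMDiffOn 𝓘(ℝ, Coord n) (𝓡 n).tangent ∞
      (fun x => (⟨φ.symm x, v x⟩ : TangentBundle (𝓡 n) M)) φ.target) :
    ContMDiffOn 𝓘(ℝ, Coord n) 𝓘(ℝ) ∞ (fun x => h.inner (φ.symm x) (u x) (v x)) φ.target := by
  intro x hx
  have : ContMDiffWithinAt 𝓘(ℝ, Coord n) ((𝓡 n).prod 𝓘(ℝ)) ∞
      (fun x ↦ Bundle.TotalSpace.mk' ℝ (E := Bundle.Trivial M ℝ) (φ.symm x)
        (h.inner (φ.symm x) (u x) (v x))) φ.target x := by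
    apply ContMDiffWithinAt.clm_bundle_apply₂ (F₁ := Coord n) (F₂ := Coord n)
      (E₁ := fun p : M => TangentSpace (𝓡 n) p) (E₂ := fun p : M => TangentSpace (𝓡 n) p)
    · exact ContMDiffAt.comp_contMDiffWithinAt x h.contMDiff.contMDiffAt
        (contMDiffOn_symm_of_mem_maximalAtlas hφ x hx)
    · exact hu x hx
    · exact hv x hx
  simp only [Bundle.contMDiffWithinAt_totalSpace] at this
  exact this.2

theorem contDiffOn_chartMetric (hφ : φ ∈ IsManifold.maximalAtlas (𝓡 n) ∞ M) :
    ContDiffOn ℝ ∞ (chartMetric h φ) φ.target := by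
  refine contDiffOn_clm_apply.2 fun u => contDiffOn_clm_apply.2 fun v => ?_
  rw [← contMDiffOn_iff_contDiffOn]
  exact contMDiffOn_inner h hφ (contMDiffOn_coordVec hφ u) (contMDiffOn_coordVec hφ v)

theorem contDiffOn_chartForm (hφ : φ ∈ IsManifold.maximalAtlas (𝓡 n) ∞ M)
    (hW : ContMDiff (𝓡 n) (𝓡 n).tangent ∞
      (fun p : M => (⟨p, W p⟩ : TangentBundle (𝓡 n) M))) :
    ContDiffOn ℝ ∞ (chartForm h W φ) φ.target := by
  refine contDiffOn_clm_apply.2 fun v => ?_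
  rw [← contMDiffOn_iff_contDiffOn]
  exact contMDiffOn_inner h hφ
    (hW.comp_contMDiffOn (contMDiffOn_symm_of_mem_maximalAtlas hφ)) (contMDiffOn_coordVec hφ v)

end Charts

/-! ### Closedness of the dual form and changes of charts -/

section ClosedForms

variable {E : Type*} [NormedAddCommGroup E] [NormedSpace ℝ E]

/-- The pull-back of a closed 1-form is closed. -/
theorem fderiv_symm_of_pullback {F : Type*} [NormedAddCommGroup F] [NormedSpace ℝ F]
    {w₁ : E → E →L[ℝ] ℝ} {w₂ : F → F →L[ℝ] ℝ} {τ : E → F} {x : E}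
    (hτ : ContDiffAt ℝ 2 τ x) (hw₂ : DifferentiableAt ℝ w₂ (τ x))
    (heq : w₁ =ᶠ[𝓝 x] fun z => (w₂ (τ z)).comp (fderiv ℝ τ z))
    (hclosed : ∀ u v, fderiv ℝ w₂ (τ x) u v = fderiv ℝ w₂ (τ x) v u) (u v : E) :
    fderiv ℝ w₁ x u v = fderiv ℝ w₁ x v u := by
  have hsymm : IsSymmSndFDerivAt ℝ τ x := hτ.isSymmSndFDerivAt (by simp)
  have h1 : HasFDerivAt (fderiv ℝ τ) (fderiv ℝ (fderiv ℝ τ) x) x :=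
    ((hτ.fderiv_right (m := 1) (by norm_num)).differentiableAt (by simp)).hasFDerivAt
  have h2 : HasFDerivAt (fun z => w₂ (τ z)) _ x :=
    HasFDerivAt.comp x (g := w₂) hw₂.hasFDerivAt (hτ.differentiableAt (by simp)).hasFDerivAt
  have h3 := h2.clm_comp h1
  rw [heq.fderiv_eq, h3.fderiv]
  simp [hclosed (fderiv ℝ τ x u), hsymm.eq u v]

theorem covDerivForm_sub_swap {g : E → E →L[ℝ] E →L[ℝ] ℝ} {w : E → E →L[ℝ] ℝ} {x : E}
    (hsymm : ∀ x u v, g x u v = g x v u) (hg : DifferentiableAt ℝ g x) (X v u : E) :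
    covDerivForm g w x X v u - covDerivForm g w x X u v =
      fderiv ℝ w x u v - fderiv ℝ w x v u := by
  have := fderiv_bilin_symm hsymm hg X u v
  simp only [covDerivForm, christoffelForm]
  linarith

end ClosedForms

section Charts

variable {n : ℕ} {M : Type*} [TopologicalSpace M] [ChartedSpace (Coord n) M]
  [IsManifold (𝓡 n) ∞ M]
  (h : RiemMetric n M) {W : (p : M) → TangentSpace (𝓡 n) p}
  {φ ψ : OpenPartialHomeomorph M (Coord n)}

theorem chartMetric_symm (x u v : Coord n) : chartMetric h φ x u v = chartMetric h φ x v u :=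
  h.symm _ _ _

theorem chartMetric_pos (hφ : φ ∈ IsManifold.maximalAtlas (𝓡 n) ∞ M) {x : Coord n}
    (hx : x ∈ φ.target) {y : Coord n} (hy : y ≠ 0) : 0 < chartMetric h φ x y y :=
  h.pos _ _ (coordVec_ne_zero hφ hx hy)

theorem differentiableAt_chartMetric (hφ : φ ∈ IsManifold.maximalAtlas (𝓡 n) ∞ M) {x : Coord n}
    (hx : x ∈ φ.target) : DifferentiableAt ℝ (chartMetric h φ) x :=
  ((contDiffOn_chartMetric h hφ).contDiffAt (φ.open_target.mem_nhds hx)).differentiableAt (by simp)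

theorem differentiableAt_chartForm (hφ : φ ∈ IsManifold.maximalAtlas (𝓡 n) ∞ M)
    (hW : ContMDiff (𝓡 n) (𝓡 n).tangent ∞
      (fun p : M => (⟨p, W p⟩ : TangentBundle (𝓡 n) M))) {x : Coord n}
    (hx : x ∈ φ.target) : DifferentiableAt ℝ (chartForm h W φ) x :=
  ((contDiffOn_chartForm h W hφ hW).contDiffAt (φ.open_target.mem_nhds hx)).differentiableAt
    (by simp)

theorem christoffel_eq (hφ : φ ∈ IsManifold.maximalAtlas (𝓡 n) ∞ M) {x : Coord n}
    (hx : x ∈ φ.target) (u v w : Coord n) :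
    christoffel h φ x u v w = christoffelForm (chartMetric h φ) x u v w := by
  have hd : ∀ a b c : Coord n, fderiv ℝ (fun z => metricCoord h φ z a b) x c =
      fderiv ℝ (chartMetric h φ) x c a b := fun a b c => by
    simp_rw [← chartMetric_apply h]
    rw [(hasFDerivAt_apply_bilin (differentiableAt_chartMetric h hφ hx)).fderiv]
    rfl
  simp only [christoffel, christoffelForm, hd]

theorem covDeriv_eq (hφ : φ ∈ IsManifold.maximalAtlas (𝓡 n) ∞ M)
    (hW : ContMDiff (𝓡 n) (𝓡 n).tangent ∞
      (fun p : M => (⟨p, W p⟩ : TangentBundle (𝓡 n) M))) {x : Coord n}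
    (hx : x ∈ φ.target) (v u : Coord n) :
    covDeriv h W φ x v u =
      covDerivForm (chartMetric h φ) (chartForm h W φ) x (coordField φ W x) v u := by
  simp only [covDeriv, covDerivForm, christoffel_eq h hφ hx, ← chartForm_apply]
  have := (differentiableAt_chartForm h hφ hW hx).hasFDerivAt.clm_apply (hasFDerivAt_const v x)
  rw [this.fderiv]
  simp

theorem chartForm_eq_inner (hφ : φ ∈ IsManifold.maximalAtlas (𝓡 n) ∞ M) {x : Coord n}
    (hx : x ∈ φ.target) (u : Coord n) :
    chartForm h W φ x u = chartMetric h φ x (coordField φ W x) u := by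
  rw [chartMetric_apply, metricCoord, coordVec_coordField W hφ hx]
  rfl

theorem chartForm_coordField (hφ : φ ∈ IsManifold.maximalAtlas (𝓡 n) ∞ M)
    (hunit : ∀ p : M, h.inner p (W p) (W p) = 1) {x : Coord n} (hx : x ∈ φ.target) :
    chartForm h W φ x (coordField φ W x) = 1 := by
  rw [chartForm_apply, coField, coordVec_coordField W hφ hx, hunit]

/-- The covariant components in two charts are related by pull-back under the change of charts. -/
theorem chartForm_eq_pullback (hφ : φ ∈ IsManifold.maximalAtlas (𝓡 n) ∞ M)
    (hψ : ψ ∈ IsManifold.maximalAtlas (𝓡 n) ∞ M) {z : Coord n} (hz : z ∈ ψ.target)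
    (hzφ : ψ.symm z ∈ φ.source) :
    chartForm h W ψ z =
      (chartForm h W φ (φ (ψ.symm z))).comp (fderiv ℝ (fun z => φ (ψ.symm z)) z) := by
  ext v
  have hbase : φ.symm (φ (ψ.symm z)) = ψ.symm z := φ.left_inv hzφ
  have htransport : ∀ {p q : M}, p = q → ∀ v : Coord n,
      h.inner p (W p) (v : TangentSpace (𝓡 n) p) = h.inner q (W q) (v : TangentSpace (𝓡 n) q) := by
    rintro p _ rfl v
    rfl
  have h1 : (mfderiv 𝓘(ℝ, Coord n) (𝓡 n) ψ.symm z v : Coord n) =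
      mfderiv 𝓘(ℝ, Coord n) (𝓡 n) φ.symm (φ (ψ.symm z))
        (fderiv ℝ (fun z => φ (ψ.symm z)) z v) := by
    have hψd := (mdifferentiable_of_mem_maximalAtlas hψ).mdifferentiableAt_symm hz
    have hφd := (mdifferentiable_of_mem_maximalAtlas hφ).mdifferentiableAt hzφ
    have hφd' := (mdifferentiable_of_mem_maximalAtlas hφ).mdifferentiableAt_symm
      (φ.map_source hzφ)
    have hev : (φ.symm ∘ (fun z => φ (ψ.symm z))) =ᶠ[𝓝 z] ψ.symm := by
      filter_upwards [(ψ.continuousAt_symm hz).preimage_mem_nhds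
        (φ.open_source.mem_nhds hzφ)] with y hy
      exact φ.left_inv hy
    have hτ : MDifferentiableAt 𝓘(ℝ, Coord n) 𝓘(ℝ, Coord n) (fun z => φ (ψ.symm z)) z :=
      hφd.comp z hψd
    have h2 := mfderiv_comp z hφd' hτ
    rw [mfderiv_eq_fderiv] at h2
    have h3 := hev.mfderiv_eq (I := 𝓘(ℝ, Coord n)) (I' := 𝓡 n)
    have h4 := h3.symm.trans h2
    exact DFunLike.congr_fun h4 v
  exact (htransport hbase.symm _).trans (congrArg (fun v' : Coord n =>
    h.inner (φ.symm (φ (ψ.symm z))) (W (φ.symm (φ (ψ.symm z))))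
      (v' : TangentSpace (𝓡 n) (φ.symm (φ (ψ.symm z))))) h1)

/-- If a Killing field is parallel in one chart, then it is parallel in every other chart on the
overlap. By the Killing equation the covariant derivative is the exterior derivative of the dual
1-form, up to a factor, and closedness does not depend on the chart. -/
theorem covDeriv_eq_zero_of_chart (hφ : φ ∈ IsManifold.maximalAtlas (𝓡 n) ∞ M)
    (hψ : ψ ∈ IsManifold.maximalAtlas (𝓡 n) ∞ M)
    (hW : ContMDiff (𝓡 n) (𝓡 n).tangent ∞
      (fun p : M => (⟨p, W p⟩ : TangentBundle (𝓡 n) M))) (hK : IsKilling h W) {x : Coord n}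
    (hx : x ∈ ψ.target) (hxφ : ψ.symm x ∈ φ.source)
    (hpar : ∀ v u, covDeriv h W φ (φ (ψ.symm x)) v u = 0) (v u : Coord n) :
    covDeriv h W ψ x v u = 0 := by
  have hx' := φ.map_source hxφ
  have hclosed : ∀ u v, fderiv ℝ (chartForm h W φ) (φ (ψ.symm x)) u v =
      fderiv ℝ (chartForm h W φ) (φ (ψ.symm x)) v u := by
    intro u v
    have := covDerivForm_sub_swap (w := chartForm h W φ) (chartMetric_symm h)
      (differentiableAt_chartMetric h hφ hx') (coordField φ W (φ (ψ.symm x))) v u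
    rw [← covDeriv_eq h hφ hW hx', ← covDeriv_eq h hφ hW hx', hpar, hpar] at this
    linarith
  have hτ : ContDiffAt ℝ 2 (fun z => φ (ψ.symm z)) x := by
    have h1 : ContMDiffAt 𝓘(ℝ, Coord n) 𝓘(ℝ, Coord n) ∞ (fun z => φ (ψ.symm z)) x :=
      (contMDiffAt_of_mem_maximalAtlas hφ hxφ).comp x (contMDiffAt_symm_of_mem_maximalAtlas hψ hx)
    exact mod_cast contDiffAt_infty.1 h1.contDiffAt 2
  have hswap := fderiv_symm_of_pullback hτ (differentiableAt_chartForm h hφ hW hx') (by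
    filter_upwards [ψ.open_target.mem_nhds hx, (ψ.continuousAt_symm hx).preimage_mem_nhds
      (φ.open_source.mem_nhds hxφ)] with z hz hzφ
    exact chartForm_eq_pullback h hφ hψ hz hzφ) hclosed u v
  have h2 := covDerivForm_sub_swap (w := chartForm h W ψ) (chartMetric_symm h)
    (differentiableAt_chartMetric h hψ hx) (coordField ψ W x) v u
  rw [← covDeriv_eq h hψ hW hx, ← covDeriv_eq h hψ hW hx, hswap] at h2
  linarith [hK ψ hψ x hx v u]

/-! ### Projective flatness in a chart -/

theorem hasRectilinearExtremals_riem_iff (hφ : φ ∈ IsManifold.maximalAtlas (𝓡 n) ∞ M) :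
    HasRectilinearExtremals {y : TangentBundle (𝓡 n) M | y.2 ≠ 0}
      (fun y => Real.sqrt (h.inner y.1 y.2 y.2)) φ ↔
    StraightLinesAreGeodesics (chartMetric h φ) φ.target := by
  rw [← riem_rectilinear_iff (chartMetric_symm h) φ.open_target (contDiffOn_chartMetric h hφ)
    fun x hx y hy => chartMetric_pos h hφ hx hy]
  refine forall₃_congr fun a b c => forall_congr' fun _ => ?_
  have hadm : IsAdmissible {y : TangentBundle (𝓡 n) M | y.2 ≠ 0} φ a b c ↔
      ContDiff ℝ ∞ c ∧ ∀ t ∈ Icc a b, c t ∈ φ.target ∧ deriv c t ≠ 0 := by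
    refine and_congr_right fun _ => forall₂_congr fun t _ => and_congr_right fun ht => ?_
    refine ⟨fun h1 h0 => h1 ?_, fun h1 => coordVec_ne_zero hφ ht h1⟩
    change coordVec φ (c t) (deriv c t) = 0
    rw [h0]
    exact map_zero (mfderiv 𝓘(ℝ, Coord n) (𝓡 n) φ.symm (c t))
  rw [hadm, and_imp]
  rfl

theorem hasRectilinearExtremals_kropina_iff (hφ : φ ∈ IsManifold.maximalAtlas (𝓡 n) ∞ M)
    (hW : ContMDiff (𝓡 n) (𝓡 n).tangent ∞
      (fun p : M => (⟨p, W p⟩ : TangentBundle (𝓡 n) M)))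
    (hunit : ∀ p : M, h.inner p (W p) (W p) = 1) (hK : IsKilling h W) (k : M → ℝ) :
    HasRectilinearExtremals (kropinaDomain h W k) (kropinaMetric h W k) φ ↔
    (∀ x ∈ φ.target, ∀ v u, covDeriv h W φ x v u = 0) ∧
      StraightLinesAreGeodesics (chartMetric h φ) φ.target := by
  have hcov : (∀ x ∈ φ.target, ∀ v u, covDeriv h W φ x v u = 0) ↔
      ∀ x ∈ φ.target, ∀ v u,
        covDerivForm (chartMetric h φ) (chartForm h W φ) x (coordField φ W x) v u = 0 :=
    forall₂_congr fun x hx => by simp only [covDeriv_eq h hφ hW hx]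
  rw [hcov, ← kropina_rectilinear_iff (chartMetric_symm h) φ.open_target
    (contDiffOn_chartMetric h hφ) (contDiffOn_chartForm h W hφ hW)
    (fun x hx y hy => chartMetric_pos h hφ hx hy)
    (fun x hx u => chartForm_eq_inner h hφ hx u)
    (fun x hx => chartForm_coordField h hφ hunit hx)
    (fun x hx u v => by
      rw [← covDeriv_eq h hφ hW hx, ← covDeriv_eq h hφ hW hx]
      exact hK φ hφ x hx u v)]
  refine forall₃_congr fun a b c => forall_congr' fun _ => ?_
  have hadm : IsAdmissible (kropinaDomain h W k) φ a b c ↔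
      ContDiff ℝ ∞ c ∧ ∀ t ∈ Icc a b, c t ∈ φ.target ∧ 0 < chartForm h W φ (c t) (deriv c t) := by
    refine and_congr_right fun _ => forall₂_congr fun t _ => and_congr_right fun _ => ?_
    exact mul_pos_iff_of_pos_left (mul_pos two_pos (Real.exp_pos _))
  -- The conformal factor `e^{-k}` cancels in the quotient `α² / β`.
  have hL : ∀ x y : Coord n, kropinaMetric h W k ⟨φ.symm x, coordVec φ x y⟩ =
      chartMetric h φ x y y / (2 * chartForm h W φ x y) := by
    intro x y
    change Real.exp (-k (φ.symm x)) * metricCoord h φ x y y /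
      (2 * Real.exp (-k (φ.symm x)) * coField h W φ x y) = _
    rw [mul_comm 2, mul_assoc, mul_div_mul_left _ _ (Real.exp_pos _).ne']
    rfl
  rw [hadm, and_imp]
  simp only [IsExtremal, length, hL]
  rfl

end Charts

end KropinaGeometry

end

open KropinaGeometry in
theorem mainTheorem5 {n : ℕ} (hn : 2 ≤ n) {M : Type*} [TopologicalSpace M]
    [ChartedSpace (EuclideanSpace ℝ (Fin n)) M] [IsManifold (𝓡 n) ∞ M]
    (h : KropinaGeometry.RiemMetric n M)
    (W : (p : M) → TangentSpace (𝓡 n) p)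
    (hW : ContMDiff (𝓡 n) (𝓡 n).tangent ∞
      (fun p : M => (⟨p, W p⟩ : TangentBundle (𝓡 n) M)))
    (hunit : ∀ p : M, h.inner p (W p) (W p) = 1)
    (hKilling : KropinaGeometry.IsKilling h W)
    (k : M → ℝ) (hk : ContMDiff (𝓡 n) 𝓘(ℝ) ∞ k) :
    KropinaGeometry.IsProjectivelyFlat (KropinaGeometry.kropinaDomain h W k)
        (KropinaGeometry.kropinaMetric h W k) ↔
      KropinaGeometry.IsParallel h W ∧ KropinaGeometry.IsRiemProjectivelyFlat h := by
  constructor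
  · intro H
    refine ⟨fun ψ hψ x hx v u => ?_, fun p => ?_⟩
    · obtain ⟨φ, hφ, hp, hrect⟩ := H (ψ.symm x)
      have hpar :=
        ((hasRectilinearExtremals_kropina_iff h hφ hW hunit hKilling k).1 hrect).1
      exact covDeriv_eq_zero_of_chart h hφ hψ hW hKilling hx hp (hpar _ (φ.map_source hp)) v u
    · obtain ⟨φ, hφ, hp, hrect⟩ := H p
      exact ⟨φ, hφ, hp, (hasRectilinearExtremals_riem_iff h hφ).2
        ((hasRectilinearExtremals_kropina_iff h hφ hW hunit hKilling k).1 hrect).2⟩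
  · rintro ⟨hpar, H⟩ p
    obtain ⟨φ, hφ, hp, hrect⟩ := H p
    exact ⟨φ, hφ, hp, (hasRectilinearExtremals_kropina_iff h hφ hW hunit hKilling k).2
      ⟨fun x hx v u => hpar φ hφ x hx v u, (hasRectilinearExtremals_riem_iff h hφ).1 hrect⟩⟩
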